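/- Fix an integer $d\ge 3$ and a real number $\lambda<d$. For a $d$-regular graph $G$ on $n$ vertices, let $d=\lambda_1\ge\lambda_2\ge\dots\ge\lambda_n$ be the eigenvalues of its adjacency matrix, with multiplicity, and let $\lambda(G)=\max_{i\ge 2}|\lambda_i|=\max\{\lambda_2,|\lambda_n|\}$ be its second largest eigenvalue in absolute value. A non-backtracking random walk of length $k$ on $G$ from a vertex $w_0$ is a uniformly chosen member of the set of all sequences $(w_0,w_1,\dots,w_k)$ of vertices such that $w_{t-1}w_t$ is an edge for $1\le t\le k$ and $w_{t-1}\ne w_{t+1}$ for $1\le t\le k-1$. There are sequences $\delta_n\to 0$ and $\eta_n\to 0$, depending only on $d$ and $\lambda$, such that the following holds for every $n$, every finite simple $d$-regular graph $G=(V,E)$ on $n$ vertices with $\lambda(G)\le\lambda$ and girth at least $10\log_{d-1}\log n$, and every starting vertex $w_0\in V$. If $(w_0,w_1,\dots,w_n)$ is a non-backtracking random walk of length $n$ on $G$ from $w_0$, and $M=\max_{v\in V}|\{t\in\{0,\dots,n\}: w_t=v\}|$ is the maximal number of its visits to a single vertex, then $$\Pr\left[(1-\delta_n)\frac{\log n}{\log\log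 n}\le M\le(1+\delta_n)\frac{\log n}{\log\log n}\right]\ge 1-\eta_n .$$ That is, with high probability $M=(1+o(1))\frac{\log n}{\log\log n}$ as $n\to\infty$. -/

import Mathlib

lemma adjMatrix_isHermitian {V : Type*} (G : SimpleGraph V) [DecidableRel G.Adj] :
    (G.adjMatrix ℝ).IsHermitian := by
  ext i j
  simp [Matrix.conjTranspose_apply, SimpleGraph.adjMatrix_apply, G.adj_comm]

/-- `G` is an `(n, d, lam)`-graph, where `n` is the number of vertices: it is `d`-regular,
`lam < d`, and `lam` is the second largest absolute value of an eigenvalue. The eigenvalues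
`λ₁ ≥ λ₂ ≥ … ≥ λₙ` of the adjacency matrix, listed with multiplicity, are `eigenvalues₀ 0`,
`eigenvalues₀ 1`, …; `lam` is the maximum of `|λᵢ|` over `i ≥ 2`,
that is `max {λ₂, |λₙ|}`. -/
def IsNDLGraph {V : Type*} [Fintype V] [DecidableEq V] (G : SimpleGraph V)
    [DecidableRel G.Adj] (n d : ℕ) (lam : ℝ) : Prop :=
  Fintype.card V = n ∧ G.IsRegularOfDegree d ∧ lam < d ∧
    IsGreatest
      {x : ℝ | ∃ i : Fin (Fintype.card V), 0 < (i : ℕ) ∧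
        x = |(adjMatrix_isHermitian G).eigenvalues₀ i|} lam

/-- `(w 0, …, w k)` is a non-backtracking walk of length `k` in `G` that starts at `w₀`. -/
def IsNonBacktrackingWalk {V : Type*} (G : SimpleGraph V) (w₀ : V) (k : ℕ)
    (w : Fin (k + 1) → V) : Prop :=
  w 0 = w₀ ∧
    (∀ s t : Fin (k + 1), (t : ℕ) = s + 1 → G.Adj (w s) (w t)) ∧
    (∀ s t : Fin (k + 1), (t : ℕ) = s + 2 → w s ≠ w t)

open Classical in
/-- The finite set of all non-backtracking walks of length `k` from `w₀`. -/
noncomputable def nonBacktrackingWalks {V : Type*} [Fintype V] (G : SimpleGraph V)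
    (w₀ : V) (k : ℕ) : Finset (Fin (k + 1) → V) :=
  Finset.univ.filter (IsNonBacktrackingWalk G w₀ k)

open Classical in
/-- The probability that a non-backtracking random walk of length `k` from `w₀`, that is, a
uniformly chosen member of `nonBacktrackingWalks G w₀ k`, has the property `A`. -/
noncomputable def nonBacktrackingProb {V : Type*} [Fintype V] (G : SimpleGraph V)
    (w₀ : V) (k : ℕ) (A : (Fin (k + 1) → V) → Prop) : ℝ :=
  (((nonBacktrackingWalks G w₀ k).filter A).card : ℝ) / ((nonBacktrackingWalks G w₀ k).card : ℝ)

/-- The number of visits of the walk `(w 0, …, w k)` to the vertex `v`. -/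
def visits {V : Type*} [DecidableEq V] {k : ℕ} (w : Fin (k + 1) → V) (v : V) : ℕ :=
  (Finset.univ.filter fun t => w t = v).card

/-- The maximal number of visits of the walk `(w 0, …, w k)` to a single vertex. -/
def maxVisits {V : Type*} [Fintype V] [DecidableEq V] {k : ℕ} (w : Fin (k + 1) → V) : ℕ :=
  Finset.univ.sup fun v => visits w v

/-! Write ℓ = log n, y = log log n and L = ℓ/y. Apart from short-term returns, the number of visits
to a fixed vertex behaves like a Poisson variable of mean about 1, whose tail at m is roughly
m^(-m); n vertices therefore produce a maximum near L. Two facts control the dependence between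
visits. The spectral gap makes every hitting probability equal to 1/n up to 1/n² after C log n steps
(`exists_mixing`): non-backtracking walk counts satisfy a three-term recurrence in the adjacency
matrix, which is solved in an eigenbasis. The girth bounds the return probability at every positive
time by d/ℓ^5 (`hitProb_return_le_of_girth`), so returns before mixing contribute o(1) in
expectation.

Upper bound: decomposing at the first visit and weighting the remaining time T by (1+θ)^T, each
return costs a factor β = τε + 2/(nθ) (`visitProb_succ_le`). With θ = L/n, β is at most 3y/ℓ and
(1+θ)^n = n^(o(1)), so a union bound over the vertices excludes more than (1+δ)L visits.

Lower bound: about (1-δ)L phases are used, each consisting of a mixing time followed by M ≈ n/(L K)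
steps, with K = ℓ^(δ/2). A second moment estimate shows that a phase is likely to hit a proportion κ
= M/(4n) of any given set with at least ℓ^5 elements (`walkExp_card_lt_le`). Iterating on the part
already hit in every phase (`walkExp_phases_le`), about κ^j n vertices survive j phases, and this is
still at least ℓ^5 when j ≈ (1-δ)L.

Both bounds hold for fixed δ and large n; a diagonal choice of δ then yields a single sequence. -/

namespace NonBacktracking

open Finset

variable {V : Type*} [Fintype V] [DecidableEq V] (G : SimpleGraph V) [DecidableRel G.Adj]

/-! ### Sums and expectations over non-backtracking walks -/

/-- The vertices to which a non-backtracking walk may proceed after its last two vertices `p.1` and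
`p.2`. For `p = (v, v)` these are all neighbours of `v`: such a `p` stands for a fresh start. -/
def nextVertices (p : V × V) : Finset V := (G.neighborFinset p.2).erase p.1

/-- The sum of `F` over all non-backtracking continuations of length `k` from the state `p`. -/
def walkSum : ℕ → V × V → (List V → ℝ) → ℝ
  | 0, _, F => F []
  | k + 1, p, F => ∑ w ∈ nextVertices G p, walkSum k (p.2, w) fun l => F (w :: l)

/-- The expectation of `F` over a non-backtracking random walk of length `k` from the state `p`;
`F` is applied to the list of the vertices that follow `p.2`. -/
noncomputable def walkExp : ℕ → V × V → (List V → ℝ) → ℝ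
  | 0, _, F => F []
  | k + 1, p, F => (∑ w ∈ nextVertices G p, walkExp k (p.2, w) fun l => F (w :: l)) /
      (nextVertices G p).card

/-- The list `l` continues the state `p` to a non-backtracking walk. -/
def IsContinuation : V × V → List V → Prop
  | _, [] => True
  | p, w :: l => w ∈ nextVertices G p ∧ IsContinuation (p.2, w) l

/-- The last two vertices after continuing the state `p` by the list `l`. -/
def finalState : V × V → List V → V × V
  | p, [] => p
  | p, w :: l => finalState (p.2, w) l

variable {G}

lemma mem_nextVertices {p : V × V} {w : V} : w ∈ nextVertices G p ↔ w ≠ p.1 ∧ G.Adj p.2 w := by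
  simp [nextVertices]

lemma card_nextVertices_of_adj {d : ℕ} (hG : G.IsRegularOfDegree d) {p : V × V}
    (hp : G.Adj p.1 p.2) : (nextVertices G p).card = d - 1 := by
  rw [nextVertices, card_erase_of_mem (by simpa using hp.symm), G.card_neighborFinset_eq_degree,
    hG p.2]

lemma card_nextVertices_self {d : ℕ} (hG : G.IsRegularOfDegree d) (v : V) :
    (nextVertices G (v, v)).card = d := by
  rw [nextVertices, erase_eq_of_notMem (by simp), G.card_neighborFinset_eq_degree, hG v]

lemma card_nextVertices_pos {d : ℕ} (hG : G.IsRegularOfDegree d) (hd : 3 ≤ d) (p : V × V) :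
    0 < (nextVertices G p).card := by
  have h := pred_card_le_card_erase (s := G.neighborFinset p.2) (a := p.1)
  rw [G.card_neighborFinset_eq_degree, hG p.2] at h
  exact lt_of_lt_of_le (by omega) h

lemma walkExp_mono {k : ℕ} {p : V × V} {F F' : List V → ℝ}
    (h : ∀ l, l.length = k → IsContinuation G p l → F l ≤ F' l) :
    walkExp G k p F ≤ walkExp G k p F' := by
  induction k generalizing p F F' with
  | zero => exact h [] rfl trivial
  | succ k ih =>
    refine div_le_div_of_nonneg_right (sum_le_sum fun w hw => ih fun l hl hc => ?_) (by positivity)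
    exact h _ (by simp [hl]) ⟨hw, hc⟩

lemma walkExp_congr {k : ℕ} {p : V × V} {F F' : List V → ℝ}
    (h : ∀ l, l.length = k → IsContinuation G p l → F l = F' l) :
    walkExp G k p F = walkExp G k p F' :=
  le_antisymm (walkExp_mono fun l hl hc => (h l hl hc).le)
    (walkExp_mono fun l hl hc => (h l hl hc).ge)

lemma walkExp_add (k : ℕ) (p : V × V) (F F' : List V → ℝ) :
    walkExp G k p (fun l => F l + F' l) = walkExp G k p F + walkExp G k p F' := by
  induction k generalizing p F F' with
  | zero => rfl
  | succ k ih => simp only [walkExp, ih, sum_add_distrib, add_div]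

lemma walkExp_const_mul (k : ℕ) (p : V × V) (c : ℝ) (F : List V → ℝ) :
    walkExp G k p (fun l => c * F l) = c * walkExp G k p F := by
  induction k generalizing p F with
  | zero => rfl
  | succ k ih => simp only [walkExp, ih, ← mul_sum, mul_div_assoc]

lemma walkExp_zero_fun (k : ℕ) (p : V × V) : walkExp G k p (fun _ => 0) = 0 := by
  simpa using walkExp_const_mul (G := G) k p 0 fun _ => 0

lemma walkExp_sum {ι : Type*} (s : Finset ι) (k : ℕ) (p : V × V) (F : ι → List V → ℝ) :
    walkExp G k p (fun l => ∑ i ∈ s, F i l) = ∑ i ∈ s, walkExp G k p (F i) := by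
  classical
  induction s using Finset.induction_on with
  | empty => simpa using walkExp_zero_fun k p
  | insert i s hi ih => simp only [sum_insert hi, walkExp_add, ih]

lemma walkExp_const {d : ℕ} (hG : G.IsRegularOfDegree d) (hd : 3 ≤ d) (k : ℕ) (p : V × V)
    (c : ℝ) : walkExp G k p (fun _ => c) = c := by
  induction k generalizing p with
  | zero => rfl
  | succ k ih =>
    have := card_nextVertices_pos hG hd p
    simp only [walkExp, ih, sum_const, nsmul_eq_mul]
    field_simp

lemma walkExp_nonneg {k : ℕ} {p : V × V} {F : List V → ℝ} (h : ∀ l, 0 ≤ F l) :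
    0 ≤ walkExp G k p F := by
  simpa [walkExp_zero_fun] using walkExp_mono (G := G) (k := k) (p := p) (F := fun _ => 0)
    (F' := F) fun l _ _ => h l

/-- An expectation is at most a bound for all the expectations after the first step. -/
lemma walkExp_succ_le {k : ℕ} {p : V × V} {F : List V → ℝ} {c : ℝ} (hc : 0 ≤ c)
    (h : ∀ w ∈ nextVertices G p, walkExp G k (p.2, w) (fun l => F (w :: l)) ≤ c) :
    walkExp G (k + 1) p F ≤ c := by
  -- Without successors the average is `0 / 0 = 0`; this case is the reason for `0 ≤ c`.
  rcases Nat.eq_zero_or_pos (nextVertices G p).card with h0 | h0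
  · simpa [walkExp, h0] using hc
  · rw [walkExp, div_le_iff₀ (by exact_mod_cast h0), mul_comm, ← nsmul_eq_mul]
    exact sum_le_card_nsmul _ _ _ h

/-- The Markov property: given the first `s` steps, the future depends on them only through the last
two vertices. -/
lemma walkExp_append (s t : ℕ) (p : V × V) (F : List V → ℝ) :
    walkExp G (s + t) p F =
      walkExp G s p fun l => walkExp G t (finalState p l) fun l' => F (l ++ l') := by
  induction s generalizing p F with
  | zero => simp [walkExp, finalState]
  | succ s ih =>
    rw [Nat.succ_add]
    simp only [walkExp, ih, finalState, List.cons_append]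

/-- By regularity every step from an edge state has exactly `d - 1` options, so the uniform measure
on walks is the law of the Markov chain behind `walkExp`. -/
lemma walkSum_eq_of_adj {d : ℕ} (hG : G.IsRegularOfDegree d) (hd : 3 ≤ d) (k : ℕ) {p : V × V}
    (hp : G.Adj p.1 p.2) (F : List V → ℝ) :
    walkSum G k p F = ((d : ℝ) - 1) ^ k * walkExp G k p F := by
  have hd' : (3 : ℝ) ≤ d := by exact_mod_cast hd
  induction k generalizing p F with
  | zero => simp [walkSum, walkExp]
  | succ k ih =>
    have h1 : walkSum G (k + 1) p F = ∑ w ∈ nextVertices G p,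
        ((d : ℝ) - 1) ^ k * walkExp G k (p.2, w) fun l => F (w :: l) :=
      sum_congr rfl fun w hw => ih (mem_nextVertices.1 hw).2 _
    rw [h1, walkExp, card_nextVertices_of_adj hG hp, ← mul_sum, Nat.cast_sub (by omega),
      Nat.cast_one]
    have : (d : ℝ) - 1 ≠ 0 := by linarith
    field_simp
    ring

lemma walkSum_succ_self {d : ℕ} (hG : G.IsRegularOfDegree d) (hd : 3 ≤ d) (k : ℕ) (v : V)
    (F : List V → ℝ) :
    walkSum G (k + 1) (v, v) F = d * ((d : ℝ) - 1) ^ k * walkExp G (k + 1) (v, v) F := by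
  have h1 : walkSum G (k + 1) (v, v) F = ∑ w ∈ nextVertices G (v, v),
      ((d : ℝ) - 1) ^ k * walkExp G k (v, w) fun l => F (w :: l) :=
    sum_congr rfl fun w hw => walkSum_eq_of_adj hG hd k (mem_nextVertices.1 hw).2 _
  rw [h1, walkExp, card_nextVertices_self hG, ← mul_sum]
  have : (d : ℝ) ≠ 0 := by positivity
  field_simp

lemma IsContinuation.adj_finalState {p : V × V} {l : List V} (hp : G.Adj p.1 p.2)
    (h : IsContinuation G p l) : G.Adj (finalState p l).1 (finalState p l).2 := by
  induction l generalizing p with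
  | nil => exact hp
  | cons w l ih => exact ih (mem_nextVertices.1 h.1).2 h.2

open Classical in
lemma walkSum_eq_sum (k : ℕ) (p : V × V) (F : List V → ℝ) :
    walkSum G k p F =
      ∑ f : Fin k → V, if IsContinuation G p (List.ofFn f) then F (List.ofFn f) else 0 := by
  induction k generalizing p F with
  | zero => simp [walkSum, IsContinuation]
  | succ k ih =>
    rw [← (Fin.consEquiv fun _ : Fin (k + 1) => V).sum_comp, Fintype.sum_prod_type]
    simp only [walkSum, ih, Fin.consEquiv, Equiv.coe_fn_mk, List.ofFn_cons, IsContinuation]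
    rw [← sum_filter_add_sum_filter_not univ (· ∈ nextVertices G p),
      filter_mem_eq_inter, univ_inter, sum_eq_zero (s := filter _ _), add_zero]
    · refine sum_congr rfl fun w hw => ?_
      simp [hw]
    · intro w hw
      simp only [mem_filter, mem_univ, true_and] at hw
      simp [hw]

/-- The free predecessor `u` is what the induction needs, since dropping the first vertex turns `w
0` into the predecessor. For `u = w 0` the last condition follows from adjacency. -/
lemma isContinuation_ofFn_tail_iff {k : ℕ} (u : V) (w : Fin (k + 1) → V) :
    IsContinuation G (u, w 0) (List.ofFn (Fin.tail w)) ↔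
      (∀ s t : Fin (k + 1), (t : ℕ) = s + 1 → G.Adj (w s) (w t)) ∧
      (∀ s t : Fin (k + 1), (t : ℕ) = s + 2 → w s ≠ w t) ∧
      ∀ t : Fin (k + 1), (t : ℕ) = 1 → u ≠ w t := by
  induction k generalizing u with
  | zero =>
    simp only [List.ofFn_zero, IsContinuation, true_iff]
    refine ⟨fun s t h => ?_, fun s t h => ?_, fun t h => ?_⟩ <;> omega
  | succ k ih =>
    have h0 : Fin.tail w 0 = w 1 := rfl
    rw [List.ofFn_succ]
    change (_ ∈ _ ∧ IsContinuation G (w 0, Fin.tail w 0) (List.ofFn (Fin.tail (Fin.tail w)))) ↔ _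
    rw [ih, mem_nextVertices, h0]
    simp only [Fin.forall_fin_succ (n := k + 1), Fin.tail]
    constructor
    · rintro ⟨⟨h1, h2⟩, h3, h4, h5⟩
      refine ⟨⟨⟨by simp, fun t ht => ?_⟩, fun s => ⟨by simp, fun t ht => h3 s t (by simpa using ht)⟩⟩,
        ⟨⟨by simp, fun t ht => h5 t (by simpa using ht)⟩,
          fun s => ⟨by simp, fun t ht => h4 s t (by simp at ht; omega)⟩⟩,
        by simp, fun t ht => ?_⟩
      · have : t = 0 := by ext; simpa using ht
        subst this; exact h2
      · have : t = 0 := by ext; simpa using ht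
        subst this; exact h1.symm
    · rintro ⟨⟨⟨-, h1⟩, h2⟩, ⟨⟨-, h3⟩, h4⟩, -, h5⟩
      exact ⟨⟨(h5 0 (by simp)).symm, h1 0 (by simp)⟩,
        fun s t ht => (h2 s).2 t (by simpa using ht),
        fun s t ht => (h4 s).2 t (by simp; omega),
        fun t ht => h3 t (by simpa using ht)⟩

lemma isNonBacktrackingWalk_iff {k : ℕ} (w₀ : V) (w : Fin (k + 1) → V) :
    IsNonBacktrackingWalk G w₀ k w ↔
      w 0 = w₀ ∧ IsContinuation G (w₀, w₀) (List.ofFn (Fin.tail w)) := by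
  rw [IsNonBacktrackingWalk]
  refine and_congr_right fun h => ?_
  subst h
  rw [isContinuation_ofFn_tail_iff]
  refine ⟨fun h => ⟨h.1, h.2, fun t ht => ?_⟩, fun h => ⟨h.1, h.2.1⟩⟩
  exact (h.1 0 t (by simpa using ht)).ne

open Classical in
lemma sum_nonBacktrackingWalks (k : ℕ) (w₀ : V) (F : List V → ℝ) :
    ∑ w ∈ nonBacktrackingWalks G w₀ k, F (List.ofFn w) =
      walkSum G k (w₀, w₀) fun l => F (w₀ :: l) := by
  rw [walkSum_eq_sum, nonBacktrackingWalks, sum_filter,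
    ← (Fin.consEquiv fun _ : Fin (k + 1) => V).sum_comp, Fintype.sum_prod_type, sum_eq_single w₀]
  · simp [Fin.consEquiv, isNonBacktrackingWalk_iff]
  · intro w _ hw
    refine sum_eq_zero fun f _ => ?_
    simp [Fin.consEquiv, isNonBacktrackingWalk_iff, hw]
  · simp

open Classical in
/-- The probability of an event of a non-backtracking random walk is the expectation of its
indicator. -/
lemma nonBacktrackingProb_eq_walkExp {d : ℕ} (hG : G.IsRegularOfDegree d) (hd : 3 ≤ d) (k : ℕ)
    (w₀ : V) (Q : List V → Prop) :
    nonBacktrackingProb G w₀ (k + 1) (fun w => Q (List.ofFn w)) =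
      walkExp G (k + 1) (w₀, w₀) fun l => if Q (w₀ :: l) then 1 else 0 := by
  have h1 : (((nonBacktrackingWalks G w₀ (k + 1)).filter fun w => Q (List.ofFn w)).card : ℝ) =
      ∑ w ∈ nonBacktrackingWalks G w₀ (k + 1), if Q (List.ofFn w) then (1 : ℝ) else 0 := by
    simp
  have h2 : ((nonBacktrackingWalks G w₀ (k + 1)).card : ℝ) =
      ∑ w ∈ nonBacktrackingWalks G w₀ (k + 1), (1 : ℝ) := by
    simp
  have hd' : (3 : ℝ) ≤ d := by exact_mod_cast hd
  rw [nonBacktrackingProb, h1, h2,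
    sum_nonBacktrackingWalks (k + 1) w₀ fun l => if Q l then (1 : ℝ) else 0,
    sum_nonBacktrackingWalks (k + 1) w₀ fun _ => 1,
    walkSum_succ_self hG hd, walkSum_succ_self hG hd, walkExp_const hG hd]
  have h3 : ((d : ℝ) - 1) ^ k ≠ 0 := pow_ne_zero _ (by linarith)
  have h4 : (d : ℝ) ≠ 0 := by linarith
  field_simp

lemma visits_eq_count {V : Type*} [DecidableEq V] {k : ℕ} (w : Fin (k + 1) → V) (v : V) :
    visits w v = (List.ofFn w).count v := by
  have key : ∀ (m : ℕ) (f : Fin m → V),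
      (∑ i, if f i = v then 1 else 0) = (List.ofFn f).count v := by
    intro m
    induction m with
    | zero => simp
    | succ m ih =>
      intro f
      rw [Fin.sum_univ_succ, ih fun i => f i.succ, List.ofFn_succ, List.count_cons, add_comm]
      simp
  rw [visits, card_filter, key]

/-- The probability that a walk from the state `p` is at `x` after `t` steps. -/
noncomputable def hitProb (G : SimpleGraph V) [DecidableRel G.Adj] (t : ℕ) (p : V × V) (x : V) :
    ℝ :=
  walkExp G t p fun l => if (finalState p l).2 = x then 1 else 0

end NonBacktracking

/-! ### Girth and return probabilities -/

namespace NonBacktracking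

open Finset

variable {V : Type*} [Fintype V] [DecidableEq V] {G : SimpleGraph V} [DecidableRel G.Adj]

lemma finalState_append {V : Type*} (p : V × V) (l l' : List V) :
    finalState p (l ++ l') = finalState (finalState p l) l' := by
  induction l generalizing p with
  | nil => rfl
  | cons w l ih => exact ih _

lemma hitProb_append (s t : ℕ) (p : V × V) (x : V) :
    hitProb G (s + t) p x = walkExp G s p fun l => hitProb G t (finalState p l) x := by
  simp only [hitProb, walkExp_append s t, finalState_append]

lemma hitProb_succ (t : ℕ) (p : V × V) (x : V) :
    hitProb G (t + 1) p x =
      (∑ w ∈ nextVertices G p, hitProb G t (p.2, w) x) / (nextVertices G p).card := rfl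

lemma hitProb_nonneg (t : ℕ) (p : V × V) (x : V) : 0 ≤ hitProb G t p x :=
  walkExp_nonneg fun l => by split_ifs <;> simp

/-- Non-backtracking walks with the same ends and a total length below the girth coincide. -/
lemma walk_unique_of_length_lt_girth {V : Type*} {G : SimpleGraph V} {u v : V} {p q : G.Walk u v}
    (hp : p.edges.IsChain (· ≠ ·)) (hq : q.edges.IsChain (· ≠ ·))
    (h : p.length + q.length < G.girth) : p = q := by
  classical
  -- The edges of both walks are too few to contain a cycle, so they span a forest. There, walks
  -- without immediate reversal are paths, and paths are determined by their ends.
  set S : Set (Sym2 V) := {e | e ∈ p.edges ++ q.edges} with hS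
  set H : SimpleGraph V := SimpleGraph.fromEdgeSet S with hH
  have hHG : H ≤ G := by
    intro a b hab
    rw [hH, SimpleGraph.fromEdgeSet_adj] at hab
    have h1 : s(a, b) ∈ p.edges ++ q.edges := hab.1
    rcases List.mem_append.1 h1 with h2 | h2
    · exact p.adj_of_mem_edges h2
    · exact q.adj_of_mem_edges h2
  have hacyc : H.IsAcyclic := by
    intro a c hc
    have h1 : G.girth ≤ c.length := by
      have := SimpleGraph.girth_le_length (hc.mapLe hHG)
      simpa using this
    have h2 : c.edges.length ≤ (p.edges ++ q.edges).length := by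
      refine (hc.edges_nodup.subperm fun e he => ?_).length_le
      have h3 := c.edges_subset_edgeSet he
      rw [hH, SimpleGraph.edgeSet_fromEdgeSet] at h3
      exact h3.1
    simp only [SimpleGraph.Walk.length_edges, List.length_append] at h2
    omega
  have hmem : ∀ {r : G.Walk u v}, (∀ e ∈ r.edges, e ∈ S) → ∀ e ∈ r.edges, e ∈ H.edgeSet := by
    intro r hr e he
    rw [hH, SimpleGraph.edgeSet_fromEdgeSet]
    exact ⟨hr e he, G.not_isDiag_of_mem_edgeSet (r.edges_subset_edgeSet he)⟩
  have hp1 : ∀ e ∈ p.edges, e ∈ H.edgeSet := hmem fun e he => List.mem_append_left _ he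
  have hq1 : ∀ e ∈ q.edges, e ∈ H.edgeSet := hmem fun e he => List.mem_append_right _ he
  have hp2 : (p.transfer H hp1).IsPath := by
    rw [hacyc.isPath_iff_isChain, SimpleGraph.Walk.edges_transfer]; exact hp
  have hq2 : (q.transfer H hq1).IsPath := by
    rw [hacyc.isPath_iff_isChain, SimpleGraph.Walk.edges_transfer]; exact hq
  have heq := congrArg Subtype.val ((hacyc.subsingleton_path u v).elim ⟨_, hp2⟩ ⟨_, hq2⟩)
  have hs := congrArg SimpleGraph.Walk.support heq
  simp only [SimpleGraph.Walk.support_transfer] at hs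
  exact SimpleGraph.Walk.ext_support hs

/-- Prepending the incoming pair to the edge list carries the non-backtracking condition through the
induction. For a fresh start `p = (v, v)` it is a loop, which differs from every edge. -/
lemma IsContinuation.exists_walk {p : V × V} {l : List V} (h : IsContinuation G p l) :
    ∃ (v : V) (W : G.Walk p.2 v), v = (finalState p l).2 ∧ W.support = p.2 :: l ∧
      (s(p.1, p.2) :: W.edges).IsChain (· ≠ ·) := by
  induction l generalizing p with
  | nil => exact ⟨p.2, .nil, rfl, rfl, List.isChain_singleton _⟩
  | cons w l ih =>
    obtain ⟨v, W, hv, hW, hc⟩ := ih h.2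
    obtain ⟨h1, h2⟩ := mem_nextVertices.1 h.1
    refine ⟨v, .cons h2 W, hv, by simp [hW], ?_⟩
    rw [SimpleGraph.Walk.edges_cons, List.isChain_cons_cons]
    refine ⟨fun he => ?_, hc⟩
    rcases Sym2.eq_iff.1 he with ⟨-, h3⟩ | ⟨h3, -⟩
    · exact h2.ne h3
    · exact h1 h3.symm

/-- Two continuations of a state to the same vertex, with total length below the girth, coincide. -/
lemma IsContinuation.eq_of_length_lt_girth {p : V × V} {l l' : List V}
    (h : IsContinuation G p l) (h' : IsContinuation G p l')
    (hend : (finalState p l).2 = (finalState p l').2) (hlen : l.length + l'.length < G.girth) :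
    l = l' := by
  obtain ⟨v, W, hv, hW, hc⟩ := h.exists_walk
  obtain ⟨v', W', hv', hW', hc'⟩ := h'.exists_walk
  obtain rfl : v = v' := by rw [hv, hv', hend]
  have e1 := congrArg List.length hW
  have e2 := congrArg List.length hW'
  simp only [SimpleGraph.Walk.length_support, List.length_cons] at e1 e2
  have h1 : W = W' := walk_unique_of_length_lt_girth hc.tail hc'.tail (by omega)
  rw [h1, hW'] at hW
  exact (List.cons.inj hW).2.symm

/-- Of the `(d - 1) ^ r` equally likely continuations at most one ends at `x`. -/
lemma hitProb_le_of_two_mul_lt_girth {d : ℕ} (hG : G.IsRegularOfDegree d) (hd : 3 ≤ d) {r : ℕ}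
    (hr : 2 * r < G.girth) {p : V × V} (hp : G.Adj p.1 p.2) (x : V) :
    hitProb G r p x ≤ (((d : ℝ) - 1) ^ r)⁻¹ := by
  classical
  have hd' : (3 : ℝ) ≤ d := by exact_mod_cast hd
  have hpos : (0 : ℝ) < ((d : ℝ) - 1) ^ r := pow_pos (by linarith) _
  rw [inv_eq_one_div, le_div_iff₀ hpos, mul_comm, hitProb, ← walkSum_eq_of_adj hG hd r hp,
    walkSum_eq_sum]
  have h1 : (∑ f : Fin r → V, if IsContinuation G p (List.ofFn f) then
      (if (finalState p (List.ofFn f)).2 = x then (1 : ℝ) else 0) else 0) =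
      ((univ.filter fun f : Fin r → V => IsContinuation G p (List.ofFn f) ∧
        (finalState p (List.ofFn f)).2 = x).card : ℝ) := by
    simp only [← ite_and, sum_boole]
  rw [h1]
  have h2 : (univ.filter fun f : Fin r → V => IsContinuation G p (List.ofFn f) ∧
        (finalState p (List.ofFn f)).2 = x).card ≤ 1 := by
    refine card_le_one.2 fun f hf f' hf' => ?_
    simp only [mem_filter, mem_univ, true_and] at hf hf'
    refine List.ofFn_injective (hf.1.eq_of_length_lt_girth hf'.1 (hf.2.trans hf'.2.symm) ?_)
    simpa [← two_mul] using hr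
  exact_mod_cast h2

/-- In a graph of large girth, a non-backtracking walk is unlikely to be back at its start at any
given time. -/
lemma hitProb_return_le {d : ℕ} (hG : G.IsRegularOfDegree d) (hd : 3 ≤ d) {r : ℕ}
    (hr : 2 * r < G.girth) {p : V × V} (hp : G.Adj p.1 p.2) {t : ℕ} (ht : 1 ≤ t) :
    hitProb G t p p.2 ≤ (((d : ℝ) - 1) ^ r)⁻¹ := by
  have hd' : (3 : ℝ) ≤ d := by exact_mod_cast hd
  have hpos : (0 : ℝ) < ((d : ℝ) - 1) ^ r := pow_pos (by linarith) _
  -- Before time `girth` no return is possible. Later, conditioning on all but the last `r` steps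
  -- reduces the claim to `hitProb_le_of_two_mul_lt_girth`.
  rcases lt_or_ge t G.girth with h | h
  · have h0 : hitProb G t p p.2 = walkExp G t p fun _ => 0 := by
      refine walkExp_congr fun l hl hc => if_neg fun he => ?_
      have := hc.eq_of_length_lt_girth (l' := []) trivial he (by simpa [hl] using h)
      simp [this] at hl
      omega
    rw [h0, walkExp_zero_fun]
    positivity
  · obtain ⟨s, rfl⟩ : ∃ s, t = s + r := ⟨t - r, by omega⟩
    rw [hitProb_append]
    refine (walkExp_mono fun l _ hc => hitProb_le_of_two_mul_lt_girth hG hd hr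
      (hc.adj_finalState hp) _).trans ?_
    rw [walkExp_const hG hd]

end NonBacktracking

/-! ### The scalar recurrence and the eigenbasis -/

namespace NonBacktracking

open Finset

/-- A non-real root has squared norm `q`, the product of the two conjugate roots. A real root
satisfies |μ| = |z| + q/|z|, and this expression increases for |z| ≥ √q, so |z| > ρ would contradict
the bound on μ. -/
lemma norm_root_le {q ρ μ : ℝ} (hq : 0 < q) (hρ : 0 < ρ) (hρq : q ≤ ρ ^ 2)
    (hμ : |μ| ≤ ρ + q / ρ) {z : ℂ} (hz : z ^ 2 - μ * z + q = 0) : ‖z‖ ≤ ρ := by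
  have hre := congrArg Complex.re hz
  have him := congrArg Complex.im hz
  simp [pow_two] at hre him
  by_cases h0 : z.im = 0
  · have hz' : z = (z.re : ℂ) := Complex.ext rfl (by simpa using h0)
    rw [hz', Complex.norm_real, Real.norm_eq_abs]
    by_contra! hlt
    have hne : 0 < |z.re| := hρ.trans hlt
    have e1 : |μ| * |z.re| = |z.re| ^ 2 + q := by
      rw [← abs_mul, sq_abs, ← abs_of_nonneg (by positivity : 0 ≤ z.re ^ 2 + q)]
      congr 1
      rw [h0] at hre
      linarith
    have e2 : |μ| * ρ ≤ ρ ^ 2 + q := by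
      have := mul_le_mul_of_nonneg_right hμ hρ.le
      rwa [add_mul, div_mul_cancel₀ _ hρ.ne', ← pow_two] at this
    have e3 : (|z.re| ^ 2 + q) * ρ ≤ (ρ ^ 2 + q) * |z.re| := by
      rw [← e1]; nlinarith
    nlinarith [mul_pos (sub_pos.2 hlt) (show 0 < |z.re| * ρ - q by nlinarith)]
  · have h1 : μ = 2 * z.re := by
      have : z.im * (2 * z.re - μ) = 0 := by linarith
      rcases mul_eq_zero.1 this with h | h
      · exact absurd h h0
      · linarith
    have h2 : ‖z‖ ^ 2 = q := by
      rw [Complex.sq_norm, Complex.normSq_apply]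
      subst h1
      linarith
    exact (pow_le_pow_iff_left₀ (norm_nonneg z) hρ.le two_ne_zero).1 (h2.trans_le hρq)

/-- A solution of the recurrence of the non-backtracking polynomials grows no faster than a power
of `ρ`, up to a linear factor. -/
lemma abs_le_of_recurrence {q ρ μ : ℝ} (hq : 1 ≤ q) (hρ : 1 ≤ ρ) (hρq : q ≤ ρ ^ 2) (hρ' : ρ ≤ q)
    (hμ : |μ| ≤ ρ + q / ρ) (hμ' : |μ| ≤ q + 1) {x : ℕ → ℝ} (h0 : |x 0| ≤ 1)
    (h1 : x 1 = μ * x 0) (h2 : x 2 = μ * x 1 - (q + 1) * x 0)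
    (h3 : ∀ k, x (k + 3) = μ * x (k + 2) - q * x (k + 1)) (k : ℕ) :
    |x k| ≤ 4 * (q + 1) ^ 2 * (k + 1) * ρ ^ k := by
  -- With roots z₁, z₂ of the characteristic polynomial, x (k+2) - z₁ x (k+1) is geometric with
  -- ratio z₂. Summing this first-order recurrence costs the linear factor and needs no separate
  -- treatment of a double root.
  obtain ⟨s, hs⟩ := IsAlgClosed.exists_eq_mul_self ((μ : ℂ) ^ 2 - 4 * q)
  set z₁ : ℂ := (μ + s) / 2 with hz₁
  set z₂ : ℂ := (μ - s) / 2 with hz₂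
  have hsum : (μ : ℂ) = z₁ + z₂ := by rw [hz₁, hz₂]; ring
  have hprod : (q : ℂ) = z₁ * z₂ := by
    rw [hz₁, hz₂]; linear_combination (-1 / 4 : ℂ) * hs
  have hn₁ : ‖z₁‖ ≤ ρ := norm_root_le (by linarith) (by linarith) hρq hμ
    (by rw [hsum, hprod]; ring)
  have hn₂ : ‖z₂‖ ≤ ρ := norm_root_le (by linarith) (by linarith) hρq hμ
    (by rw [hsum, hprod]; ring)
  set B : ℝ := 4 * (q + 1) ^ 2 with hB
  have hx1 : |x 1| ≤ q + 1 := by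
    rw [h1, abs_mul]
    calc |μ| * |x 0| ≤ (q + 1) * 1 := mul_le_mul hμ' h0 (abs_nonneg _) (by linarith)
      _ = q + 1 := mul_one _
  have hx2 : |x 2| ≤ (q + 1) * (q + 1) + (q + 1) := by
    rw [h2]
    refine (abs_sub _ _).trans (add_le_add ?_ ?_)
    · rw [abs_mul]
      exact mul_le_mul hμ' hx1 (abs_nonneg _) (by linarith)
    · rw [abs_mul, abs_of_nonneg (by linarith : 0 ≤ q + 1)]
      nlinarith
  have hy0 : ‖(x 2 : ℂ) - z₁ * x 1‖ ≤ (q + 1) * (q + 1) + (q + 1) + q * (q + 1) := by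
    refine (norm_sub_le _ _).trans (add_le_add ?_ ?_)
    · rwa [Complex.norm_real]
    · rw [norm_mul, Complex.norm_real]
      exact mul_le_mul (hn₁.trans hρ') hx1 (norm_nonneg _) (by linarith)
  have hyk : ∀ k, ‖(x (k + 2) : ℂ) - z₁ * x (k + 1)‖ ≤
      ((q + 1) * (q + 1) + (q + 1) + q * (q + 1)) * ρ ^ k := by
    intro k
    induction k with
    | zero => simpa using hy0
    | succ k ih =>
      have e : (x (k + 1 + 2) : ℂ) - z₁ * x (k + 1 + 1) =
          z₂ * ((x (k + 2) : ℂ) - z₁ * x (k + 1)) := by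
        rw [show k + 1 + 2 = k + 3 from rfl, show k + 1 + 1 = k + 2 from rfl, h3]
        push_cast
        rw [hprod, hsum]; ring
      rw [e, norm_mul, pow_succ]
      calc ‖z₂‖ * _ ≤ ρ * (((q + 1) * (q + 1) + (q + 1) + q * (q + 1)) * ρ ^ k) :=
            mul_le_mul hn₂ ih (norm_nonneg _) (by linarith)
        _ = _ := by ring
  have hxk : ∀ k : ℕ, |x (k + 1)| ≤ B * (k + 1) * ρ ^ k := by
    intro k
    induction k with
    | zero => simp only [Nat.cast_zero, pow_zero, zero_add, mul_one, hB]; nlinarith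
    | succ k ih =>
      have e : |x (k + 2)| ≤ ‖z₁‖ * |x (k + 1)| + ‖(x (k + 2) : ℂ) - z₁ * x (k + 1)‖ := by
        have := norm_add_le (z₁ * (x (k + 1) : ℂ)) ((x (k + 2) : ℂ) - z₁ * x (k + 1))
        rwa [add_sub_cancel, norm_mul, Complex.norm_real, Complex.norm_real] at this
      have hpk : 0 ≤ ρ ^ k := by positivity
      calc |x (k + 2)| ≤ ρ * (B * (k + 1) * ρ ^ k) + B * ρ ^ k := by
            refine e.trans (add_le_add (mul_le_mul hn₁ ih (abs_nonneg _) (by linarith)) ?_)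
            exact (hyk k).trans (mul_le_mul_of_nonneg_right (by rw [hB]; nlinarith) hpk)
        _ ≤ ρ * (B * (k + 1) * ρ ^ k) + B * (ρ * ρ ^ k) := by
            gcongr
            nlinarith
        _ = B * ((k + 1 : ℕ) + 1) * ρ ^ (k + 1) := by push_cast; ring
  cases k with
  | zero =>
    simp only [Nat.cast_zero, pow_zero, zero_add, mul_one]
    nlinarith
  | succ k =>
    refine (hxk k).trans ?_
    have hpk : 0 ≤ ρ ^ k := by positivity
    have : ρ ^ k ≤ ρ ^ (k + 1) := pow_le_pow_right₀ hρ (Nat.le_succ k)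
    push_cast
    gcongr
    linarith

variable {V : Type*} [Fintype V] [DecidableEq V] {G : SimpleGraph V} [DecidableRel G.Adj]

lemma exists_eigenbasis {n d : ℕ} {lam : ℝ} (hG : IsNDLGraph G n d lam) :
    ∃ (β : V → V → ℝ) (μ : V → ℝ) (i₀ : V),
      (∀ i v, ∑ w ∈ G.neighborFinset v, β i w = μ i * β i v) ∧
      (∀ (f : V → ℝ) v, f v = ∑ i, (∑ w, β i w * f w) * β i v) ∧
      (∀ i v, |β i v| ≤ 1) ∧ ∀ i, i ≠ i₀ → |μ i| ≤ lam := by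
  obtain ⟨-, -, -, ⟨j, hj, -⟩, hup⟩ := hG
  set hA := adjMatrix_isHermitian G
  -- This is the equivalence through which `eigenvalues` is defined from `eigenvalues₀`; hence the
  -- `rfl` in the last goal.
  let e : Fin (Fintype.card V) ≃ V := Fintype.equivOfCardEq (Fintype.card_fin _)
  have hpos : 0 < Fintype.card V := lt_of_le_of_lt (Nat.zero_le _) j.2
  refine ⟨fun i v => hA.eigenvectorBasis i v, hA.eigenvalues, e ⟨0, hpos⟩, ?_, ?_, ?_, ?_⟩
  · intro i v
    have h := congrFun (hA.mulVec_eigenvectorBasis i) v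
    simpa [SimpleGraph.adjMatrix_mulVec_apply] using h
  · intro f v
    have h := congrArg (fun y : EuclideanSpace ℝ V => y v)
      (hA.eigenvectorBasis.sum_repr' (WithLp.toLp 2 f))
    simp [PiLp.inner_apply] at h
    rw [← h]
    refine sum_congr rfl fun i _ => ?_
    congr 1
    exact sum_congr rfl fun w _ => mul_comm _ _
  · intro i v
    have h := PiLp.norm_apply_le (hA.eigenvectorBasis i) v
    rwa [hA.eigenvectorBasis.orthonormal.1 i, Real.norm_eq_abs] at h
  · intro i hi
    refine hup ⟨e.symm i, ?_, rfl⟩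
    rw [Nat.pos_iff_ne_zero]
    intro h0
    exact hi (by rw [← e.symm_apply_eq]; exact Fin.ext h0)

end NonBacktracking

/-! ### Mixing from the spectral gap -/

namespace NonBacktracking

open Finset

variable {V : Type*} [Fintype V] [DecidableEq V] {G : SimpleGraph V} [DecidableRel G.Adj]

lemma sum_mul_sum_neighborFinset {V : Type*} [Fintype V] {G : SimpleGraph V} [DecidableRel G.Adj]
    (f g : V → ℝ) :
    ∑ v, f v * ∑ w ∈ G.neighborFinset v, g w = ∑ v, (∑ w ∈ G.neighborFinset v, f w) * g v := by
  simp only [mul_sum, sum_mul, SimpleGraph.neighborFinset_eq_filter, sum_filter]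
  rw [sum_comm]
  refine sum_congr rfl fun v _ => sum_congr rfl fun w _ => ?_
  simp only [G.adj_comm w v]
  split_ifs <;> simp

/-- The entries of the non-backtracking powers of the adjacency matrix are close to their mean. -/
lemma abs_sub_le_of_recurrence {n d : ℕ} {lam ρ : ℝ} (hd : 3 ≤ d) (hG : IsNDLGraph G n d lam)
    (hρ : 1 ≤ ρ) (hρq : (d : ℝ) - 1 ≤ ρ ^ 2) (hρ' : ρ ≤ (d : ℝ) - 1)
    (hlam : lam ≤ ρ + ((d : ℝ) - 1) / ρ) {a : ℕ → V → ℝ} {x : V}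
    (h0 : ∀ v, a 0 v = if v = x then 1 else 0)
    (h1 : ∀ v, a 1 v = ∑ w ∈ G.neighborFinset v, a 0 w)
    (h2 : ∀ v, a 2 v = (∑ w ∈ G.neighborFinset v, a 1 w) - d * a 0 v)
    (h3 : ∀ k v, a (k + 3) v =
      (∑ w ∈ G.neighborFinset v, a (k + 2) w) - ((d : ℝ) - 1) * a (k + 1) v)
    (k : ℕ) (v : V) :
    |a (k + 1) v - d * ((d : ℝ) - 1) ^ k / n| ≤ n * (4 * d ^ 2 * (k + 2) * ρ ^ (k + 1)) := by
  obtain ⟨β, μ, i₀, hev, hexp, hle, hμ⟩ := exists_eigenbasis hG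
  obtain ⟨hn, hreg, hlamd, -⟩ := hG
  have hd' : (3 : ℝ) ≤ d := by exact_mod_cast hd
  set c : V → ℕ → ℝ := fun i k => ∑ w, β i w * a k w with hc
  have hsymm : ∀ i (f : V → ℝ), ∑ v, β i v * ∑ w ∈ G.neighborFinset v, f w =
      μ i * ∑ v, β i v * f v := by
    intro i f
    rw [sum_mul_sum_neighborFinset, mul_sum]
    exact sum_congr rfl fun v _ => by rw [hev, mul_assoc]
  have hc0 : ∀ i, c i 0 = β i x := fun i => by simp [hc, h0]
  have hc1 : ∀ i, c i 1 = μ i * c i 0 := fun i => by simp only [hc, h1, hsymm]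
  have hc2 : ∀ i, c i 2 = μ i * c i 1 - d * c i 0 := fun i => by
    simp only [hc, h2, mul_sub, sum_sub_distrib, hsymm]
    rw [mul_sum (a := (d : ℝ))]
    congr 1
    exact sum_congr rfl fun v _ => by ring
  have hc3 : ∀ i k, c i (k + 3) = μ i * c i (k + 2) - ((d : ℝ) - 1) * c i (k + 1) := fun i k => by
    simp only [hc, h3, mul_sub, sum_sub_distrib, hsymm]
    rw [mul_sum (a := (d : ℝ) - 1)]
    congr 1
    exact sum_congr rfl fun v _ => by ring
  have hone : ∀ v, ∑ _w ∈ G.neighborFinset v, (1 : ℝ) = d * 1 := fun v => by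
    rw [sum_const, G.card_neighborFinset_eq_degree, hreg v]; simp
  -- The constant function has eigenvalue `d`, which no `i ≠ i₀` attains because `lam < d`. So those
  -- eigenvectors are orthogonal to it, and the one at `i₀` is constant; it supplies the main term.
  have horth : ∀ i, i ≠ i₀ → ∑ w, β i w = 0 := by
    intro i hi
    have h := hsymm i fun _ => 1
    simp only [hone, mul_one, ← sum_mul] at h
    have h' : (∑ w, β i w) * (d - μ i) = 0 := by linarith
    rcases mul_eq_zero.1 h' with h'' | h''
    · exact h''
    · have := (le_abs_self _).trans (hμ i hi)
      linarith
  set s : ℝ := ∑ w, β i₀ w with hs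
  have hs1 : ∀ v, s * β i₀ v = 1 := by
    intro v
    have h := hexp (fun _ => 1) v
    rw [sum_eq_single i₀ (fun i _ hi => by simp [horth i hi]) (by simp)] at h
    simpa [hs] using h.symm
  have hss : s * s = n := by
    calc s * s = ∑ w, s * β i₀ w := by rw [← mul_sum]
      _ = n := by simp [hs1, ← hn]
  have hs0 : s ≠ 0 := left_ne_zero_of_mul_eq_one (hs1 x)
  have hβ : ∀ v, β i₀ v = 1 / s := fun v => by rw [eq_div_iff hs0, mul_comm, hs1]
  have hμ0 : μ i₀ = d := by
    have h := hev i₀ x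
    simp only [hβ, sum_const, G.card_neighborFinset_eq_degree, hreg x, nsmul_eq_mul] at h
    field_simp at h
    exact h.symm
  have hc0k : ∀ k, c i₀ (k + 1) = d * ((d : ℝ) - 1) ^ k * (1 / s) := by
    intro k
    induction k using Nat.strong_induction_on with
    | _ k ih =>
      match k with
      | 0 => simp [hc1, hc0, hμ0, hβ]
      | 1 => rw [show 1 + 1 = 2 from rfl, hc2, hc1, hc0, hμ0, hβ]; ring
      | k + 2 =>
        rw [show k + 2 + 1 = k + 3 from rfl, hc3, ih (k + 1) (by omega), ih k (by omega), hμ0]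
        ring
  have hck : ∀ i, i ≠ i₀ → |c i (k + 1)| ≤ 4 * d ^ 2 * (k + 2) * ρ ^ (k + 1) := by
    intro i hi
    have h := abs_le_of_recurrence (q := (d : ℝ) - 1) (ρ := ρ) (μ := μ i) (x := c i) (by linarith)
      hρ hρq hρ' ((hμ i hi).trans hlam) ((hμ i hi).trans (by linarith)) (by rw [hc0]; exact hle i x)
      (hc1 i) (by rw [hc2]; ring) (hc3 i) (k + 1)
    refine h.trans_eq ?_
    push_cast
    ring
  have hmain : a (k + 1) v - d * ((d : ℝ) - 1) ^ k / n =
      ∑ i ∈ univ.erase i₀, c i (k + 1) * β i v := by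
    rw [hexp (a (k + 1)) v, ← add_sum_erase _ _ (mem_univ i₀)]
    have : (∑ w, β i₀ w * a (k + 1) w) * β i₀ v = d * ((d : ℝ) - 1) ^ k / n := by
      rw [← hss, hβ v]
      have := hc0k k
      simp only [hc] at this
      rw [this]
      field_simp
    rw [this]
    simp only [hc]
    ring
  rw [hmain]
  refine (abs_sum_le_sum_abs _ _).trans ?_
  have hnn : 0 ≤ 4 * (d : ℝ) ^ 2 * (k + 2) * ρ ^ (k + 1) := by positivity
  calc ∑ i ∈ univ.erase i₀, |c i (k + 1) * β i v|
      ≤ ∑ i ∈ univ.erase i₀, 4 * (d : ℝ) ^ 2 * (k + 2) * ρ ^ (k + 1) := by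
        refine sum_le_sum fun i hi => ?_
        rw [abs_mul]
        calc |c i (k + 1)| * |β i v| ≤ (4 * (d : ℝ) ^ 2 * (k + 2) * ρ ^ (k + 1)) * 1 :=
              mul_le_mul (hck i (ne_of_mem_erase hi)) (hle i v) (abs_nonneg _) hnn
          _ = _ := mul_one _
    _ ≤ ∑ _i : V, 4 * (d : ℝ) ^ 2 * (k + 2) * ρ ^ (k + 1) :=
        sum_le_sum_of_subset_of_nonneg (erase_subset _ _) fun _ _ _ => hnn
    _ = n * (4 * d ^ 2 * (k + 2) * ρ ^ (k + 1)) := by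
        rw [sum_const, card_univ, hn, nsmul_eq_mul]

/-- The number of continuations of length `t` from the state `p` to the vertex `x`. -/
def hitCount (G : SimpleGraph V) [DecidableRel G.Adj] (t : ℕ) (p : V × V) (x : V) : ℝ :=
  walkSum G t p fun l => if (finalState p l).2 = x then 1 else 0

lemma hitCount_zero (p : V × V) (x : V) : hitCount G 0 p x = if p.2 = x then 1 else 0 := rfl

lemma hitCount_succ (t : ℕ) (p : V × V) (x : V) :
    hitCount G (t + 1) p x = ∑ w ∈ nextVertices G p, hitCount G t (p.2, w) x := rfl

lemma hitCount_succ_self (t : ℕ) (v x : V) :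
    hitCount G (t + 1) (v, v) x = ∑ w ∈ G.neighborFinset v, hitCount G t (v, w) x := by
  rw [hitCount_succ, nextVertices, erase_eq_of_notMem (by simp)]

/-- Non-backtracking walks from `(u, v)` are all walks started afresh at `v`, minus those whose
first step returns to `u`. -/
lemma hitCount_succ_of_adj (t : ℕ) {u v : V} (h : G.Adj u v) (x : V) :
    hitCount G (t + 1) (u, v) x = hitCount G (t + 1) (v, v) x - hitCount G t (v, u) x := by
  rw [hitCount_succ_self, hitCount_succ, nextVertices,
    ← add_sum_erase (G.neighborFinset v) _ (a := u) (by simpa using h.symm)]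
  ring

lemma sum_hitCount_neighborFinset {d : ℕ} (hG : G.IsRegularOfDegree d) (t : ℕ) (v x : V) :
    ∑ w ∈ G.neighborFinset v, hitCount G (t + 1) (w, v) x =
      ((d : ℝ) - 1) * hitCount G (t + 1) (v, v) x := by
  have h : ∀ w ∈ G.neighborFinset v, hitCount G (t + 1) (w, v) x =
      hitCount G (t + 1) (v, v) x - hitCount G t (v, w) x := fun w hw =>
    hitCount_succ_of_adj t (by simpa using ((G.mem_neighborFinset v w).1 hw).symm) x
  rw [sum_congr rfl h, sum_sub_distrib, sum_const, G.card_neighborFinset_eq_degree, hG v,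
    ← hitCount_succ_self, nsmul_eq_mul]
  ring

/-- Together with `sum_hitCount_neighborFinset` this is the recurrence for the non-backtracking
powers of the adjacency matrix. -/
lemma hitCount_add_two_self (t : ℕ) (v x : V) :
    hitCount G (t + 2) (v, v) x = (∑ w ∈ G.neighborFinset v, hitCount G (t + 1) (w, w) x) -
      ∑ w ∈ G.neighborFinset v, hitCount G t (w, v) x := by
  rw [hitCount_succ_self, ← sum_sub_distrib]
  exact sum_congr rfl fun w hw => hitCount_succ_of_adj t (by simpa using hw) x

lemma abs_hitCount_self_sub_le {n d : ℕ} {lam ρ : ℝ} (hd : 3 ≤ d) (hG : IsNDLGraph G n d lam)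
    (hρ : 1 ≤ ρ) (hρq : (d : ℝ) - 1 ≤ ρ ^ 2) (hρ' : ρ ≤ (d : ℝ) - 1)
    (hlam : lam ≤ ρ + ((d : ℝ) - 1) / ρ) (k : ℕ) (v x : V) :
    |hitCount G (k + 1) (v, v) x - d * ((d : ℝ) - 1) ^ k / n| ≤
      n * (4 * d ^ 2 * (k + 2) * ρ ^ (k + 1)) := by
  have hreg := hG.2.1
  refine abs_sub_le_of_recurrence (a := fun k v => hitCount G k (v, v) x) (x := x) hd hG hρ hρq hρ'
    hlam (fun v => rfl) (fun v => ?_) (fun v => ?_) (fun k v => ?_) k v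
  · rw [hitCount_succ_self]
    rfl
  · rw [hitCount_add_two_self]
    congr 1
    have h : ∀ w ∈ G.neighborFinset v, hitCount G 0 (w, v) x = hitCount G 0 (v, v) x :=
      fun _ _ => rfl
    rw [sum_congr rfl h, sum_const, G.card_neighborFinset_eq_degree, hreg v, nsmul_eq_mul]
  · rw [hitCount_add_two_self, sum_hitCount_neighborFinset hreg]

/-- Applying `hitCount_succ_of_adj` repeatedly passes from fresh starts to edge states. The linear
errors of the fresh starts add up to the factor `(t + 1) ^ 2`. -/
lemma abs_hitCount_sub_le {n d : ℕ} {lam ρ : ℝ} (hd : 3 ≤ d) (hG : IsNDLGraph G n d lam)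
    (hρ : 1 ≤ ρ) (hρq : (d : ℝ) - 1 ≤ ρ ^ 2) (hρ' : ρ ≤ (d : ℝ) - 1)
    (hlam : lam ≤ ρ + ((d : ℝ) - 1) / ρ) (t : ℕ) {u v : V} (h : G.Adj u v) (x : V) :
    |hitCount G t (u, v) x - ((d : ℝ) - 1) ^ t / n| ≤ n * (4 * d ^ 2 * (t + 1) ^ 2 * ρ ^ t) := by
  have hd' : (3 : ℝ) ≤ d := by exact_mod_cast hd
  have hn : (1 : ℝ) ≤ n := by
    rw [← hG.1]
    exact_mod_cast Fintype.card_pos_iff.2 ⟨u⟩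
  induction t generalizing u v with
  | zero =>
    have h1 : (1 : ℝ) ≤ n * (4 * d ^ 2) := by nlinarith
    have h2 : 1 / (n : ℝ) ≤ 1 := by rw [div_le_one (by linarith)]; exact hn
    have h3 : 0 ≤ 1 / (n : ℝ) := by positivity
    simp only [hitCount_zero, pow_zero, Nat.cast_zero, zero_add, one_pow, mul_one]
    refine le_trans ?_ h1
    rw [abs_le]
    split_ifs <;> constructor <;> linarith
  | succ t ih =>
    have e : hitCount G (t + 1) (u, v) x - ((d : ℝ) - 1) ^ (t + 1) / n =
        (hitCount G (t + 1) (v, v) x - d * ((d : ℝ) - 1) ^ t / n) -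
          (hitCount G t (v, u) x - ((d : ℝ) - 1) ^ t / n) := by
      rw [hitCount_succ_of_adj t h]; ring
    rw [e]
    refine (abs_sub _ _).trans ((add_le_add
      (abs_hitCount_self_sub_le hd hG hρ hρq hρ' hlam t v x) (ih h.symm)).trans ?_)
    rw [← mul_add]
    have hp : ρ ^ t ≤ ρ ^ (t + 1) := pow_le_pow_right₀ hρ (Nat.le_succ t)
    have hp0 : 0 ≤ ρ ^ (t + 1) := by positivity
    refine mul_le_mul_of_nonneg_left ?_ (by linarith)
    calc 4 * (d : ℝ) ^ 2 * (t + 2) * ρ ^ (t + 1) + 4 * d ^ 2 * (t + 1) ^ 2 * ρ ^ t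
        ≤ 4 * (d : ℝ) ^ 2 * (t + 2) * ρ ^ (t + 1) + 4 * d ^ 2 * (t + 1) ^ 2 * ρ ^ (t + 1) := by
          gcongr
      _ = 4 * (d : ℝ) ^ 2 * ((t + 2) + (t + 1) ^ 2) * ρ ^ (t + 1) := by ring
      _ ≤ 4 * (d : ℝ) ^ 2 * ((t + 1 : ℕ) + 1) ^ 2 * ρ ^ (t + 1) := by
          gcongr
          push_cast
          nlinarith [(Nat.cast_nonneg t : (0 : ℝ) ≤ t)]

lemma abs_hitProb_sub_le {n d : ℕ} {lam ρ : ℝ} (hd : 3 ≤ d) (hG : IsNDLGraph G n d lam)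
    (hρ : 1 ≤ ρ) (hρq : (d : ℝ) - 1 ≤ ρ ^ 2) (hρ' : ρ ≤ (d : ℝ) - 1)
    (hlam : lam ≤ ρ + ((d : ℝ) - 1) / ρ) (t : ℕ) {p : V × V} (h : G.Adj p.1 p.2) (x : V) :
    |hitProb G t p x - 1 / n| ≤ n * (4 * d ^ 2 * (t + 1) ^ 2 * (ρ / ((d : ℝ) - 1)) ^ t) := by
  have hd' : (3 : ℝ) ≤ d := by exact_mod_cast hd
  have hq : 0 < ((d : ℝ) - 1) ^ t := pow_pos (by linarith) _
  have h1 := abs_hitCount_sub_le hd hG hρ hρq hρ' hlam t (u := p.1) (v := p.2) h x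
  have h2 : hitCount G t (p.1, p.2) x = ((d : ℝ) - 1) ^ t * hitProb G t p x :=
    walkSum_eq_of_adj hG.2.1 hd t h _
  rw [h2, show ((d : ℝ) - 1) ^ t * hitProb G t p x - ((d : ℝ) - 1) ^ t / n =
    ((d : ℝ) - 1) ^ t * (hitProb G t p x - 1 / n) by ring, abs_mul, abs_of_pos hq, mul_comm,
    ← le_div_iff₀ hq] at h1
  refine h1.trans_eq ?_
  rw [div_pow]
  ring

/-- Mixing of non-backtracking random walks in logarithmic time. -/
lemma exists_mixing {d : ℕ} (hd : 3 ≤ d) {lam₀ : ℝ} (hlam₀ : lam₀ < d) :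
    ∃ C : ℝ, 0 < C ∧ ∀ᶠ n : ℕ in Filter.atTop, ∀ (V : Type*) [Fintype V] [DecidableEq V]
      (G : SimpleGraph V) [DecidableRel G.Adj] (lam : ℝ), lam ≤ lam₀ → IsNDLGraph G n d lam →
      ∀ t : ℕ, C * Real.log n ≤ t → ∀ p : V × V, G.Adj p.1 p.2 → ∀ x : V,
        |hitProb G t p x - 1 / n| ≤ 1 / (n : ℝ) ^ 2 := by
  have hd' : (3 : ℝ) ≤ d := by exact_mod_cast hd
  set q : ℝ := (d : ℝ) - 1 with hq
  have hq2 : 2 ≤ q := by linarith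
  -- At ρ = q the last bound reads `lam₀ ≤ d` and is strict, so by continuity some ρ slightly below
  -- q works.
  obtain ⟨ρ, hρ1, hρq, hρlt, hρlam⟩ : ∃ ρ : ℝ, 1 ≤ ρ ∧ q ≤ ρ ^ 2 ∧ ρ < q ∧ lam₀ ≤ ρ + q / ρ := by
    have hcont : ContinuousAt (fun ρ : ℝ => ρ + q / ρ) q :=
      continuousAt_id.add (continuousAt_const.div continuousAt_id (by positivity))
    have hval : lam₀ < q + q / q := by rw [div_self (by positivity), hq]; linarith
    have e1 : ∀ᶠ ρ in nhdsWithin q (Set.Iio q), lam₀ < ρ + q / ρ :=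
      (hcont.eventually (lt_mem_nhds hval)).filter_mono nhdsWithin_le_nhds
    have e2 : ∀ᶠ ρ in nhdsWithin q (Set.Iio q), 1 < ρ :=
      (lt_mem_nhds (by linarith : 1 < q)).filter_mono nhdsWithin_le_nhds
    have e3 : ∀ᶠ ρ in nhdsWithin q (Set.Iio q), q < ρ ^ 2 :=
      ((continuousAt_id.pow 2).eventually
        (lt_mem_nhds (by simp only [id]; nlinarith : q < id q ^ 2))).filter_mono nhdsWithin_le_nhds
    obtain ⟨ρ, h1, h2, h3, h4⟩ := (e1.and (e2.and (e3.and self_mem_nhdsWithin))).exists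
    exact ⟨ρ, h2.le, h3.le, h4, h1.le⟩
  set κ : ℝ := ρ / q with hκ
  have hκ0 : 0 < κ := by positivity
  have hκ1 : κ < 1 := by rw [hκ, div_lt_one (by positivity)]; exact hρlt
  -- Half of the exponential decay absorbs the factor `(t + 1) ^ 2`; the other half gives n^(-4)
  -- once t ≥ 4 log n / (-log κ').
  set κ' : ℝ := Real.sqrt κ with hκ'
  have hκ'0 : 0 < κ' := Real.sqrt_pos.2 hκ0
  have hκ'1 : κ' < 1 := by rw [hκ', Real.sqrt_lt' one_pos]; simpa using hκ1
  have hκ'2 : κ = κ' * κ' := (Real.mul_self_sqrt hκ0.le).symm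
  obtain ⟨B, hB⟩ : ∃ B : ℝ, ∀ t : ℕ, ((t : ℝ) + 1) ^ 2 * κ' ^ t ≤ B := by
    have h := tendsto_pow_const_mul_const_pow_of_abs_lt_one 2
      (r := κ') (by rwa [abs_of_pos hκ'0])
    obtain ⟨B, hB⟩ := (h.comp (Filter.tendsto_add_atTop_nat 1)).bddAbove_range
    refine ⟨B / κ', fun t => ?_⟩
    have := hB ⟨t, rfl⟩
    simp only [Function.comp] at this
    rw [le_div_iff₀ hκ'0]
    push_cast at this
    rwa [pow_succ κ', ← mul_assoc] at this
  have hlog : 0 < -Real.log κ' := by linarith [Real.log_neg hκ'0 hκ'1]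
  refine ⟨4 / -Real.log κ', by positivity, ?_⟩
  filter_upwards [Filter.eventually_ge_atTop (max 1 ⌈4 * (d : ℝ) ^ 2 * B⌉₊)] with n hn
  intro V _ _ G _ lam hlam hG t ht p hp x
  have hn1 : (1 : ℝ) ≤ n := by exact_mod_cast (le_max_left _ _).trans hn
  have hnB : 4 * (d : ℝ) ^ 2 * B ≤ n :=
    (Nat.le_ceil _).trans (by exact_mod_cast (le_max_right _ _).trans hn)
  have hn0 : (0 : ℝ) < n := by linarith
  refine (abs_hitProb_sub_le hd hG hρ1 hρq hρlt.le (hlam.trans hρlam) t hp x).trans ?_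
  have hpow : κ' ^ t ≤ 1 / (n : ℝ) ^ 4 := by
    rw [← Real.log_le_log_iff (by positivity) (by positivity), Real.log_pow, one_div, Real.log_inv,
      Real.log_pow]
    rw [div_mul_eq_mul_div, div_le_iff₀ hlog] at ht
    push_cast
    linarith
  have h0 : (0 : ℝ) ≤ 4 * d ^ 2 := by positivity
  calc (n : ℝ) * (4 * d ^ 2 * (t + 1) ^ 2 * κ ^ t)
      = n * (4 * d ^ 2 * ((t + 1) ^ 2 * κ' ^ t) * κ' ^ t) := by rw [hκ'2, mul_pow]; ring
    _ ≤ n * (4 * d ^ 2 * B * κ' ^ t) := by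
        gcongr
        exact hB t
    _ ≤ n * (n * (1 / (n : ℝ) ^ 4)) := by gcongr
    _ = 1 / (n : ℝ) ^ 2 := by field_simp

end NonBacktracking

/-! ### Upper tail of the visits to one vertex -/

namespace NonBacktracking

open Finset

variable {V : Type*} [Fintype V] [DecidableEq V] {G : SimpleGraph V} [DecidableRel G.Adj]

/-- The probability that a walk of length `T` from the state `p` makes at least `m` visits to `x`
after its start. -/
noncomputable def visitProb (G : SimpleGraph V) [DecidableRel G.Adj] (m T : ℕ) (p : V × V)
    (x : V) : ℝ :=
  walkExp G T p fun l => if m ≤ l.count x then 1 else 0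

lemma visitProb_succ_zero (m : ℕ) (p : V × V) (x : V) : visitProb G (m + 1) 0 p x = 0 := by
  simp [visitProb, walkExp]

lemma walkExp_cons_eq_visitProb (m T : ℕ) (p : V × V) (x w : V) :
    walkExp G T (p.2, w) (fun l => if m + 1 ≤ (w :: l).count x then (1 : ℝ) else 0) =
      if w = x then visitProb G m T (p.2, w) x else visitProb G (m + 1) T (p.2, w) x := by
  split_ifs with h
  · subst h; simp [visitProb]
  · simp [visitProb, h]

lemma visitProb_zero {d : ℕ} (hG : G.IsRegularOfDegree d) (hd : 3 ≤ d) (T : ℕ) (p : V × V)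
    (x : V) : visitProb G 0 T p x = 1 := by
  simp [visitProb, walkExp_const hG hd]

lemma visitProb_nonneg (m T : ℕ) (p : V × V) (x : V) : 0 ≤ visitProb G m T p x :=
  walkExp_nonneg fun l => by split_ifs <;> simp

lemma hitProb_zero (p : V × V) (x : V) : hitProb G 0 p x = if p.2 = x then 1 else 0 := rfl

/-- Decomposition according to the time of the first visit. -/
lemma visitProb_succ_le_sum {m : ℕ} {x : V} {B : ℕ → ℝ}
    (hB : ∀ T, ∀ e : V × V, G.Adj e.1 e.2 → e.2 = x → visitProb G m T e x ≤ B T) (T : ℕ)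
    (p : V × V) :
    visitProb G (m + 1) T p x ≤ ∑ t ∈ range T, hitProb G (t + 1) p x * B (T - 1 - t) := by
  induction T generalizing p with
  | zero => simp [visitProb_succ_zero]
  | succ T ih =>
    have hw : ∀ w ∈ nextVertices G p,
        walkExp G T (p.2, w) (fun l => if m + 1 ≤ (w :: l).count x then (1 : ℝ) else 0) ≤
          ∑ t ∈ range (T + 1), hitProb G t (p.2, w) x * B (T - t) := by
      intro w hw
      have hadj : G.Adj p.2 w := (mem_nextVertices.1 hw).2
      have hsum : ∑ t ∈ range T, hitProb G (t + 1) (p.2, w) x * B (T - (t + 1)) =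
          ∑ t ∈ range T, hitProb G (t + 1) (p.2, w) x * B (T - 1 - t) :=
        sum_congr rfl fun t _ => by rw [Nat.sub_sub, add_comm 1 t]
      rw [walkExp_cons_eq_visitProb, sum_range_succ', hsum, hitProb_zero]
      split_ifs with h
      · have h1 := hB T (p.2, w) hadj h
        have h2 : 0 ≤ ∑ t ∈ range T, hitProb G (t + 1) (p.2, w) x * B (T - 1 - t) :=
          (visitProb_nonneg (m + 1) T (p.2, w) x).trans (ih (p.2, w))
        simp only [one_mul, Nat.sub_zero]
        linarith
      · simpa using ih (p.2, w)
    calc visitProb G (m + 1) (T + 1) p x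
        ≤ (∑ w ∈ nextVertices G p, ∑ t ∈ range (T + 1), hitProb G t (p.2, w) x * B (T - t)) /
            (nextVertices G p).card :=
          div_le_div_of_nonneg_right (sum_le_sum hw) (by positivity)
      _ = ∑ t ∈ range (T + 1), hitProb G (t + 1) p x * B (T + 1 - 1 - t) := by
          rw [sum_comm, sum_div]
          refine sum_congr rfl fun t _ => ?_
          rw [hitProb_succ, ← sum_mul, Nat.add_sub_cancel]
          ring

/-- A first return after t steps shortens the remaining time by t, which gains (1+θ)^(-t) in the
weight. Discounted in this way, the return probabilities sum to at most `τ * ε + c / θ`, the price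
of each return. -/
lemma visitProb_le_of_return {d : ℕ} (hG : G.IsRegularOfDegree d) (hd : 3 ≤ d) {τ : ℕ}
    {ε c θ : ℝ} (hε : 0 ≤ ε) (hc : 0 ≤ c) (hθ : 0 < θ)
    (hb : ∀ e : V × V, G.Adj e.1 e.2 → ∀ t, 1 ≤ t →
      hitProb G t e e.2 ≤ (if t ≤ τ then ε else 0) + c) (m T : ℕ) {e : V × V}
    (he : G.Adj e.1 e.2) :
    visitProb G m T e e.2 ≤ (1 + θ) ^ T * (τ * ε + c / θ) ^ m := by
  have h1θ : 1 ≤ 1 + θ := by linarith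
  have hβ : 0 ≤ τ * ε + c / θ := by positivity
  induction m generalizing T e with
  | zero =>
    rw [visitProb_zero hG hd, pow_zero, mul_one]
    exact one_le_pow₀ h1θ
  | succ m ih =>
    refine (visitProb_succ_le_sum (B := fun T => (1 + θ) ^ T * (τ * ε + c / θ) ^ m)
      (fun T e' he' hx => hx ▸ ih T he') T e).trans ?_
    have hgeom : ∑ t ∈ range T, (1 + θ) ^ (T - 1 - t) ≤ (1 + θ) ^ T / θ := by
      rw [sum_range_reflect (fun t => (1 + θ) ^ t) T, geom_sum_eq (by linarith), add_sub_cancel_left]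
      gcongr
      linarith
    have hshort : ∑ t ∈ range T, (if t + 1 ≤ τ then ε else 0) * (1 + θ) ^ (T - 1 - t) ≤
        τ * ε * (1 + θ) ^ T := by
      calc ∑ t ∈ range T, (if t + 1 ≤ τ then ε else 0) * (1 + θ) ^ (T - 1 - t)
          ≤ ∑ t ∈ range T, (if t ∈ range τ then ε * (1 + θ) ^ T else 0) := by
            refine sum_le_sum fun t _ => ?_
            simp only [mem_range, Nat.succ_le_iff]
            split_ifs
            · exact mul_le_mul_of_nonneg_left (pow_le_pow_right₀ h1θ (by omega)) hε
            · simp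
        _ = ∑ t ∈ range T ∩ range τ, ε * (1 + θ) ^ T := by rw [sum_ite_mem]
        _ ≤ ∑ t ∈ range τ, ε * (1 + θ) ^ T :=
            sum_le_sum_of_subset_of_nonneg inter_subset_right fun _ _ _ => by positivity
        _ = τ * ε * (1 + θ) ^ T := by rw [sum_const, card_range, nsmul_eq_mul, mul_assoc]
    calc ∑ t ∈ range T, hitProb G (t + 1) e e.2 * ((1 + θ) ^ (T - 1 - t) * (τ * ε + c / θ) ^ m)
        ≤ ∑ t ∈ range T, ((if t + 1 ≤ τ then ε else 0) + c) *
            ((1 + θ) ^ (T - 1 - t) * (τ * ε + c / θ) ^ m) := by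
          refine sum_le_sum fun t _ => mul_le_mul_of_nonneg_right (hb e he _ (by omega)) ?_
          positivity
      _ = (∑ t ∈ range T, (if t + 1 ≤ τ then ε else 0) * (1 + θ) ^ (T - 1 - t) +
            c * ∑ t ∈ range T, (1 + θ) ^ (T - 1 - t)) * (τ * ε + c / θ) ^ m := by
          rw [mul_sum, ← sum_add_distrib, sum_mul]
          exact sum_congr rfl fun t _ => by ring
      _ ≤ (τ * ε * (1 + θ) ^ T + c * ((1 + θ) ^ T / θ)) * (τ * ε + c / θ) ^ m := by gcongr
      _ = (1 + θ) ^ T * (τ * ε + c / θ) ^ (m + 1) := by ring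

/-- An upper bound for the probability of many visits to a vertex, from an arbitrary state. -/
lemma visitProb_succ_le {d : ℕ} (hG : G.IsRegularOfDegree d) (hd : 3 ≤ d) {τ : ℕ}
    {ε c θ : ℝ} (hε : 0 ≤ ε) (hc : 0 ≤ c) (hθ : 0 < θ)
    (hb : ∀ e : V × V, G.Adj e.1 e.2 → ∀ t, 1 ≤ t →
      hitProb G t e e.2 ≤ (if t ≤ τ then ε else 0) + c) (m T : ℕ) (p : V × V) (x : V) :
    visitProb G (m + 1) T p x ≤ (1 + θ) ^ T * (τ * ε + c / θ) ^ m := by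
  have hβ : 0 ≤ τ * ε + c / θ := by positivity
  induction T generalizing p with
  | zero => rw [visitProb_succ_zero]; positivity
  | succ T ih =>
    have hmono : (1 + θ) ^ T * (τ * ε + c / θ) ^ m ≤ (1 + θ) ^ (T + 1) * (τ * ε + c / θ) ^ m := by
      gcongr
      · linarith
      · omega
    refine walkExp_succ_le (by positivity) fun w hw => ?_
    rw [walkExp_cons_eq_visitProb]
    refine le_trans ?_ hmono
    split_ifs with h
    · subst h
      exact visitProb_le_of_return hG hd hε hc hθ hb m T (e := (p.2, w)) (mem_nextVertices.1 hw).2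
    · exact ih _

/-! ### First and second moments of the visits to a set -/

/-- The number of visits of a list to a set. -/
def visitsTo (A : Finset V) (l : List V) : ℝ := ∑ x ∈ A, (l.count x : ℝ)

/-- The number of pairs of visits of a list to the same element of a set. -/
def repeats (A : Finset V) : List V → ℝ
  | [] => 0
  | w :: l => (if w ∈ A then (l.count w : ℝ) else 0) + repeats A l

lemma visitsTo_cons {V : Type*} [DecidableEq V] (A : Finset V) (w : V) (l : List V) :
    visitsTo A (w :: l) = (if w ∈ A then 1 else 0) + visitsTo A l := by
  simp only [visitsTo, List.count_cons, Nat.cast_add, sum_add_distrib, beq_iff_eq, Nat.cast_ite,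
    Nat.cast_one, Nat.cast_zero, sum_ite_eq]
  ring

lemma repeats_nonneg {V : Type*} [DecidableEq V] (A : Finset V) (l : List V) : 0 ≤ repeats A l := by
  induction l with
  | nil => exact le_rfl
  | cons w l ih =>
    rw [repeats]
    split_ifs <;> positivity

/-- Every visit is either the last one to its vertex or forms a pair with a later one. This bounds
the number of distinct vertices hit from below. -/
lemma visitsTo_le_card_add_repeats {V : Type*} [DecidableEq V] (A : Finset V) (l : List V) :
    visitsTo A l ≤ ((A.filter (· ∈ l)).card : ℝ) + repeats A l := by
  induction l with
  | nil => simp [visitsTo, repeats]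
  | cons w l ih =>
    rw [visitsTo_cons, repeats]
    have hsub : A.filter (· ∈ l) ⊆ A.filter (· ∈ w :: l) := fun y hy => by
      simp only [mem_filter, List.mem_cons] at hy ⊢
      exact ⟨hy.1, Or.inr hy.2⟩
    have hcard : ((A.filter (· ∈ l)).card : ℝ) ≤ ((A.filter (· ∈ w :: l)).card : ℝ) := by
      exact_mod_cast card_le_card hsub
    split_ifs with hA
    · by_cases hl : w ∈ l
      · have : (1 : ℝ) ≤ l.count w := by exact_mod_cast List.count_pos_iff.2 hl
        linarith
      · have : (A.filter (· ∈ l)).card + 1 ≤ (A.filter (· ∈ w :: l)).card := by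
          refine card_lt_card ((ssubset_iff_of_subset hsub).2 ⟨w, ?_, ?_⟩)
          · simp [hA]
          · simp [hl]
        have : ((A.filter (· ∈ l)).card : ℝ) + 1 ≤ ((A.filter (· ∈ w :: l)).card : ℝ) := by
          exact_mod_cast this
        have : (0 : ℝ) ≤ l.count w := by positivity
        linarith
    · linarith

lemma walkExp_count {d : ℕ} (hG : G.IsRegularOfDegree d) (hd : 3 ≤ d) (M : ℕ) (p : V × V) (x : V) :
    walkExp G M p (fun l => (l.count x : ℝ)) = ∑ t ∈ range M, hitProb G (t + 1) p x := by
  induction M generalizing p with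
  | zero => simp [walkExp]
  | succ M ih =>
    have hw : ∀ w ∈ nextVertices G p, walkExp G M (p.2, w) (fun l => ((w :: l).count x : ℝ)) =
        ∑ t ∈ range (M + 1), hitProb G t (p.2, w) x := by
      intro w _
      simp only [List.count_cons, Nat.cast_add]
      rw [walkExp_add, ih, walkExp_const hG hd, sum_range_succ', hitProb_zero]
      simp
    rw [walkExp, sum_congr rfl hw, sum_comm, sum_div]
    rfl

lemma walkExp_visitsTo {d : ℕ} (hG : G.IsRegularOfDegree d) (hd : 3 ≤ d) (A : Finset V) (M : ℕ)
    (p : V × V) :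
    walkExp G M p (visitsTo A) = ∑ t ∈ range M, ∑ x ∈ A, hitProb G (t + 1) p x := by
  have h := walkExp_sum (G := G) A M p fun x l => (l.count x : ℝ)
  rw [sum_comm, ← sum_congr rfl fun x _ => walkExp_count hG hd M p x, ← h]
  rfl

lemma sum_hitProb_univ {d : ℕ} (hG : G.IsRegularOfDegree d) (hd : 3 ≤ d) (t : ℕ) (p : V × V) :
    ∑ x, hitProb G t p x = 1 := by
  simp only [hitProb]
  rw [← walkExp_sum]
  simp [walkExp_const hG hd]

lemma sum_hitProb_le_one {d : ℕ} (hG : G.IsRegularOfDegree d) (hd : 3 ≤ d) (A : Finset V) (t : ℕ)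
    (p : V × V) : ∑ x ∈ A, hitProb G t p x ≤ 1 := by
  rw [← sum_hitProb_univ hG hd t p]
  exact sum_le_sum_of_subset_of_nonneg (subset_univ _) fun x _ _ => hitProb_nonneg t p x

lemma sum_hitProb_eq_walkExp (A : Finset V) (t : ℕ) (p : V × V) :
    ∑ x ∈ A, hitProb G t p x =
      walkExp G t p fun l => if (finalState p l).2 ∈ A then 1 else 0 := by
  simp only [hitProb]
  rw [← walkExp_sum]
  simp

/-- After each visit to `A` the expected number of further visits to the same vertex is at most `σ`.
-/
lemma walkExp_repeats_le {d : ℕ} (hG : G.IsRegularOfDegree d) (hd : 3 ≤ d) (A : Finset V) {M : ℕ}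
    {σ : ℝ} (hσ : ∀ M' ≤ M, ∀ e : V × V, G.Adj e.1 e.2 →
      walkExp G M' e (fun l => (l.count e.2 : ℝ)) ≤ σ) (p : V × V) :
    walkExp G M p (repeats A) ≤ σ * walkExp G M p (visitsTo A) := by
  induction M generalizing p with
  | zero => simp [walkExp, repeats, visitsTo]
  | succ M ih =>
    rw [walkExp, walkExp, ← mul_div_assoc, mul_sum]
    refine div_le_div_of_nonneg_right (sum_le_sum fun w hw => ?_) (by positivity)
    have ih' := ih (fun M' hM' => hσ M' (by omega)) (p.2, w)
    have hw' := hσ M (by omega) (p.2, w) (mem_nextVertices.1 hw).2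
    simp only [repeats, visitsTo_cons]
    rw [walkExp_add, walkExp_add, walkExp_const hG hd, mul_add]
    refine add_le_add ?_ ih'
    split_ifs
    · simpa using hw'
    · simp [walkExp_zero_fun]

lemma walkExp_finalState_succ (s : ℕ) (p : V × V) (g : V × V → ℝ) :
    walkExp G (s + 1) p (fun l => g (finalState p l)) =
      walkExp G s p fun l => (∑ w ∈ nextVertices G (finalState p l), g ((finalState p l).2, w)) /
        (nextVertices G (finalState p l)).card := by
  rw [walkExp_append]
  simp only [finalState_append]
  rfl

lemma walkExp_visitsTo_le {d : ℕ} (hG : G.IsRegularOfDegree d) (hd : 3 ≤ d) {A : Finset V}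
    {τ : ℕ} {a : ℝ} (ha : 0 ≤ a)
    (hA : ∀ e : V × V, G.Adj e.1 e.2 → ∀ t, τ ≤ t → ∑ x ∈ A, hitProb G t e x ≤ a) (M : ℕ)
    {e : V × V} (he : G.Adj e.1 e.2) : walkExp G M e (visitsTo A) ≤ τ + M * a := by
  rw [walkExp_visitsTo hG hd]
  calc ∑ t ∈ range M, ∑ x ∈ A, hitProb G (t + 1) e x
      ≤ ∑ t ∈ range M, ((if t ∈ range τ then 1 else 0) + a) := by
        refine sum_le_sum fun t _ => ?_
        split_ifs with h
        · linarith [sum_hitProb_le_one hG hd A (t + 1) e]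
        · rw [mem_range] at h
          linarith [hA e he (t + 1) (by omega)]
    _ = ∑ t ∈ range M ∩ range τ, (1 : ℝ) + M * a := by
        rw [sum_add_distrib, sum_ite_mem, sum_const (b := a), card_range, nsmul_eq_mul]
    _ ≤ ∑ t ∈ range τ, (1 : ℝ) + M * a := by
        refine add_le_add ?_ le_rfl
        exact sum_le_sum_of_subset_of_nonneg inter_subset_right fun _ _ _ => zero_le_one
    _ = τ + M * a := by simp

/-- With Z the later visits, (1_A + Z)² = 1_A (1 + 2Z) + Z². The walk is in `A` with probability at
most `a`, and then Z has mean at most `τ + M * a`. The induction treats Z² by absorbing the step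
into the burn-in time `s`, which is why `s` varies. -/
lemma walkExp_sq_visitsTo_le {d : ℕ} (hG : G.IsRegularOfDegree d) (hd : 3 ≤ d) {A : Finset V}
    {τ : ℕ} {a : ℝ} (ha : 0 ≤ a)
    (hA : ∀ e : V × V, G.Adj e.1 e.2 → ∀ t, τ ≤ t → ∑ x ∈ A, hitProb G t e x ≤ a) (M s : ℕ)
    (hs : τ ≤ s) {e : V × V} (he : G.Adj e.1 e.2) :
    walkExp G s e (fun l => walkExp G M (finalState e l) fun l' => visitsTo A l' ^ 2) ≤
      M * a * (1 + 2 * τ) + (M * a) ^ 2 := by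
  induction M generalizing s with
  | zero => simp [walkExp, visitsTo, walkExp_zero_fun]
  | succ M ih =>
    have hstep : ∀ p : V × V, walkExp G (M + 1) p (fun l' => visitsTo A l' ^ 2) =
        (∑ w ∈ nextVertices G p, ((if w ∈ A then 1 else 0) *
          (1 + 2 * walkExp G M (p.2, w) (visitsTo A)) +
            walkExp G M (p.2, w) fun l' => visitsTo A l' ^ 2)) / (nextVertices G p).card := by
      intro p
      rw [walkExp]
      congr 1
      refine sum_congr rfl fun w _ => ?_
      have hsq : ∀ l, visitsTo A (w :: l) ^ 2 = ((if w ∈ A then 1 else 0) +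
          (2 * if w ∈ A then 1 else 0) * visitsTo A l) + visitsTo A l ^ 2 := fun l => by
        rw [visitsTo_cons]
        split_ifs <;> ring
      simp only [hsq]
      rw [walkExp_add, walkExp_add, walkExp_const hG hd, walkExp_const_mul]
      split_ifs <;> ring
    have hrw := walkExp_finalState_succ (G := G) s e fun p => (if p.2 ∈ A then 1 else 0) *
      (1 + 2 * walkExp G M p (visitsTo A)) + walkExp G M p fun l' => visitsTo A l' ^ 2
    simp only [hstep]
    rw [← hrw, walkExp_add]
    have h1 : walkExp G (s + 1) e (fun l => (if (finalState e l).2 ∈ A then 1 else 0) *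
        (1 + 2 * walkExp G M (finalState e l) (visitsTo A))) ≤ a * (1 + 2 * (τ + M * a)) := by
      calc _ ≤ walkExp G (s + 1) e (fun l => (1 + 2 * (τ + M * a)) *
              (if (finalState e l).2 ∈ A then 1 else 0)) := by
            refine walkExp_mono fun l _ hl => ?_
            have := walkExp_visitsTo_le hG hd ha hA M (hl.adj_finalState he)
            split_ifs
            · linarith
            · simp
        _ = (1 + 2 * (τ + M * a)) * ∑ x ∈ A, hitProb G (s + 1) e x := by
            rw [walkExp_const_mul, sum_hitProb_eq_walkExp]
        _ ≤ (1 + 2 * (τ + M * a)) * a := by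
            gcongr
            exact hA e he _ (by omega)
        _ = _ := mul_comm _ _
    refine (add_le_add h1 (ih (s + 1) (by omega))).trans ?_
    push_cast
    nlinarith [sq_nonneg a]

end NonBacktracking

/-! ### Lower bound by phases -/

namespace NonBacktracking

open Finset

variable {V : Type*} [Fintype V] [DecidableEq V] {G : SimpleGraph V} [DecidableRel G.Adj]

/-- If D < μ/4, then either Z < μ/2, a large deviation of Z, or R ≥ μ/4. Both terms on the right can
be averaged, as in Chebyshev's and Markov's inequalities. -/
lemma ite_lt_le_chebyshev {D Z R μ : ℝ} (hμ : 0 < μ) (hR : 0 ≤ R) (h : Z ≤ D + R) :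
    (if D < μ / 4 then (1 : ℝ) else 0) ≤ 4 / μ ^ 2 * (Z - μ) ^ 2 + 4 / μ * R := by
  have h1 : 0 ≤ 4 / μ ^ 2 * (Z - μ) ^ 2 := by positivity
  have h2 : 0 ≤ 4 / μ * R := by positivity
  split_ifs with hD
  · rcases lt_or_ge Z (μ / 2) with hZ | hZ
    · have : 1 ≤ 4 / μ ^ 2 * (Z - μ) ^ 2 := by
        rw [div_mul_eq_mul_div, le_div_iff₀ (by positivity)]
        nlinarith
      linarith
    · have : 1 ≤ 4 / μ * R := by
        rw [div_mul_eq_mul_div, le_div_iff₀ hμ]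
        linarith
      linarith
  · linarith

/-- A walk of length `τ + M`, where `τ` is the mixing time, visits a positive proportion of the
expected number of elements of a given set, with high probability. -/
lemma walkExp_card_lt_le {n d : ℕ} (hG : G.IsRegularOfDegree d) (hd : 3 ≤ d)
    (hn : 1 ≤ n) {τ M : ℕ} {σ : ℝ} {A : Finset V} (hM : 0 < M) (hA : A.Nonempty)
    (hmix : ∀ e : V × V, G.Adj e.1 e.2 → ∀ t, τ ≤ t → ∀ x,
      |hitProb G t e x - 1 / n| ≤ 1 / (n : ℝ) ^ 2)
    (hσ0 : 0 ≤ σ) (hσ : ∀ M' ≤ M, ∀ e : V × V, G.Adj e.1 e.2 →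
      walkExp G M' e (fun l => (l.count e.2 : ℝ)) ≤ σ)
    {e : V × V} (he : G.Adj e.1 e.2) :
    walkExp G (τ + M) e (fun l => if ((A.filter (· ∈ l)).card : ℝ) < M / (4 * n) * A.card then 1
      else 0) ≤ 8 * (1 + 2 * τ) * n / (M * A.card) + 20 / n + 8 * σ := by
  have hn1 : (1 : ℝ) ≤ n := by exact_mod_cast hn
  have hn0 : (0 : ℝ) < n := by linarith
  have hA0 : (0 : ℝ) < A.card := by exact_mod_cast hA.card_pos
  have hM0 : (0 : ℝ) < M := by exact_mod_cast hM
  set α : ℝ := A.card / n with hα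
  have hα0 : 0 < α := by positivity
  set μ : ℝ := M * α with hμ
  have hμ0 : 0 < μ := by positivity
  have hup : ∀ e : V × V, G.Adj e.1 e.2 → ∀ t, τ ≤ t →
      ∑ x ∈ A, hitProb G t e x ≤ α * (1 + 1 / n) := by
    intro e he t ht
    calc ∑ x ∈ A, hitProb G t e x ≤ ∑ _x ∈ A, (1 / (n : ℝ) + 1 / (n : ℝ) ^ 2) :=
          sum_le_sum fun x _ => by linarith [(abs_le.1 (hmix e he t ht x)).2]
      _ = α * (1 + 1 / n) := by
          rw [sum_const, nsmul_eq_mul, hα]; field_simp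
  have hlow : ∀ e : V × V, G.Adj e.1 e.2 → ∀ t, τ ≤ t →
      α * (1 - 1 / n) ≤ ∑ x ∈ A, hitProb G t e x := by
    intro e he t ht
    calc α * (1 - 1 / n) = ∑ _x ∈ A, (1 / (n : ℝ) - 1 / (n : ℝ) ^ 2) := by
          rw [sum_const, nsmul_eq_mul, hα]; field_simp
      _ ≤ ∑ x ∈ A, hitProb G t e x :=
          sum_le_sum fun x _ => by linarith [(abs_le.1 (hmix e he t ht x)).1]
  have hEZ : walkExp G τ e (fun l => walkExp G M (finalState e l) (visitsTo A)) =
      ∑ t ∈ range M, ∑ x ∈ A, hitProb G (τ + (t + 1)) e x := by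
    simp only [walkExp_visitsTo hG hd]
    rw [walkExp_sum]
    refine sum_congr rfl fun t _ => ?_
    rw [walkExp_sum]
    exact sum_congr rfl fun x _ => (hitProb_append τ (t + 1) e x).symm
  have hEZup : walkExp G τ e (fun l => walkExp G M (finalState e l) (visitsTo A)) ≤
      μ * (1 + 1 / n) := by
    rw [hEZ]
    refine (sum_le_sum fun t _ => hup e he _ (by omega)).trans_eq ?_
    rw [sum_const, card_range, nsmul_eq_mul, hμ]; ring
  have hEZlow : μ * (1 - 1 / n) ≤
      walkExp G τ e (fun l => walkExp G M (finalState e l) (visitsTo A)) := by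
    rw [hEZ]
    refine le_trans (Eq.le ?_) (sum_le_sum fun t _ => hlow e he _ (by omega))
    rw [sum_const, card_range, nsmul_eq_mul, hμ]; ring
  have hEZ2 := walkExp_sq_visitsTo_le hG hd (a := α * (1 + 1 / n)) (by positivity) hup M τ le_rfl he
  have hER : walkExp G τ e (fun l => walkExp G M (finalState e l) (repeats A)) ≤
      σ * (μ * (1 + 1 / n)) := by
    refine (walkExp_mono fun l _ _ => walkExp_repeats_le hG hd A hσ (finalState e l)).trans ?_
    rw [walkExp_const_mul]
    exact mul_le_mul_of_nonneg_left hEZup hσ0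
  set E1 := walkExp G τ e (fun l => walkExp G M (finalState e l) (visitsTo A)) with hE1
  set E2 := walkExp G τ e (fun l => walkExp G M (finalState e l) fun l' => visitsTo A l' ^ 2)
    with hE2
  set ER := walkExp G τ e (fun l => walkExp G M (finalState e l) (repeats A)) with hER'
  have hmain : walkExp G (τ + M) e (fun l => if ((A.filter (· ∈ l)).card : ℝ) <
      M / (4 * n) * A.card then 1 else 0) ≤
        4 / μ ^ 2 * (E2 - 2 * μ * E1 + μ ^ 2) + 4 / μ * ER := by
    rw [walkExp_append]
    have hpt : ∀ l l' : List V, (if ((A.filter (· ∈ l ++ l')).card : ℝ) < M / (4 * n) * A.card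
        then (1 : ℝ) else 0) ≤ 4 / μ ^ 2 * visitsTo A l' ^ 2 +
          ((-(8 / μ)) * visitsTo A l' + (4 + 4 / μ * repeats A l')) := by
      intro l l'
      have h1 : ((A.filter (· ∈ l')).card : ℝ) ≤ ((A.filter (· ∈ l ++ l')).card : ℝ) := by
        refine Nat.cast_le.2 (card_le_card fun y hy => ?_)
        simp only [mem_filter, List.mem_append] at hy ⊢
        exact ⟨hy.1, Or.inr hy.2⟩
      have h2 := ite_lt_le_chebyshev (D := ((A.filter (· ∈ l ++ l')).card : ℝ)) hμ0
        (repeats_nonneg A l') ((visitsTo_le_card_add_repeats A l').trans (by linarith))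
      have h3 : (M : ℝ) / (4 * n) * A.card = μ / 4 := by
        rw [hμ, hα]; field_simp
      rw [h3]
      refine h2.trans_eq ?_
      field_simp
      ring
    refine (walkExp_mono fun l _ _ => walkExp_mono fun l' _ _ => hpt l l').trans_eq ?_
    simp only [walkExp_add, walkExp_const_mul, walkExp_const hG hd]
    rw [← hE1, ← hE2, ← hER']
    field_simp
    ring
  refine hmain.trans ?_
  have hinv : 1 / (n : ℝ) ≤ 1 := by rw [div_le_one hn0]; exact hn1
  have hinv0 : 0 ≤ 1 / (n : ℝ) := by positivity
  set ν : ℝ := 1 / n with hν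
  have hvar : E2 - 2 * μ * E1 + μ ^ 2 ≤ 2 * μ * (1 + 2 * τ) + 5 * μ ^ 2 * ν := by
    have h1 : E2 ≤ μ * (1 + ν) * (1 + 2 * τ) + (μ * (1 + ν)) ^ 2 := by
      refine hEZ2.trans_eq ?_
      rw [hμ]; ring
    have h2 : 2 * μ * (μ * (1 - ν)) ≤ 2 * μ * E1 := by gcongr
    have h3 : μ * (1 + ν) * (1 + 2 * τ) ≤ 2 * μ * (1 + 2 * τ) := by
      refine mul_le_mul_of_nonneg_right ?_ (by positivity)
      nlinarith
    have h4 : μ ^ 2 * ν ^ 2 ≤ μ ^ 2 * ν := by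
      refine mul_le_mul_of_nonneg_left ?_ (by positivity)
      nlinarith
    nlinarith
  have hrep : ER ≤ 2 * σ * μ := by
    refine hER.trans ?_
    have : σ * μ * ν ≤ σ * μ * 1 := mul_le_mul_of_nonneg_left hinv (by positivity)
    nlinarith
  calc 4 / μ ^ 2 * (E2 - 2 * μ * E1 + μ ^ 2) + 4 / μ * ER
      ≤ 4 / μ ^ 2 * (2 * μ * (1 + 2 * τ) + 5 * μ ^ 2 * ν) + 4 / μ * (2 * σ * μ) := by gcongr
    _ = 8 * (1 + 2 * τ) * n / (M * A.card) + 20 / n + 8 * σ := by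
        rw [hμ, hν, hα]
        field_simp
        ring

/-- Iteration over phases: if in each phase a walk is likely to visit a proportion `κ` of any given
large set, then after `j` phases it is likely to have visited many vertices `j` times. -/
lemma walkExp_phases_le {d : ℕ} (hG : G.IsRegularOfDegree d) (hd : 3 ≤ d) {T : ℕ} {κ N ζ : ℝ}
    (hκ0 : 0 ≤ κ) (hκ1 : κ ≤ 1) (hζ : 0 ≤ ζ)
    (hphase : ∀ e : V × V, G.Adj e.1 e.2 → ∀ A : Finset V, N ≤ A.card →
      walkExp G T e (fun l => if ((A.filter (· ∈ l)).card : ℝ) < κ * A.card then 1 else 0) ≤ ζ)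
    (j : ℕ) {e : V × V} (he : G.Adj e.1 e.2) {A : Finset V} (hA : N ≤ κ ^ j * A.card) :
    walkExp G (j * T) e (fun l => if ((A.filter fun v => j ≤ l.count v).card : ℝ) < κ ^ j * A.card
      then 1 else 0) ≤ j * ζ := by
  induction j generalizing e A with
  | zero => simp [walkExp]
  | succ j ih =>
    rw [show (j + 1) * T = T + j * T by ring, walkExp_append]
    -- Unless the first phase fails, the part of `A` that it hits has at least `κ * A.card`
    -- elements, and the induction hypothesis applies to that part.
    have hinner : ∀ l, IsContinuation G e l →
        walkExp G (j * T) (finalState e l) (fun l' =>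
          if ((A.filter fun v => j + 1 ≤ (l ++ l').count v).card : ℝ) < κ ^ (j + 1) * A.card
            then 1 else 0) ≤
        (if ((A.filter (· ∈ l)).card : ℝ) < κ * A.card then 1 else 0) + j * ζ := by
      intro l hl
      split_ifs with hlt
      · have h1 : walkExp G (j * T) (finalState e l) (fun l' =>
            if ((A.filter fun v => j + 1 ≤ (l ++ l').count v).card : ℝ) < κ ^ (j + 1) * A.card
              then 1 else 0) ≤ walkExp G (j * T) (finalState e l) (fun _ => 1) :=
          walkExp_mono fun l' _ _ => by split_ifs <;> simp
        rw [walkExp_const hG hd] at h1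
        have : 0 ≤ j * ζ := by positivity
        linarith
      · push Not at hlt
        have hle : κ ^ (j + 1) * A.card ≤ κ ^ j * (A.filter (· ∈ l)).card := by
          rw [pow_succ, mul_assoc]
          exact mul_le_mul_of_nonneg_left hlt (by positivity)
        rw [zero_add]
        refine le_trans (walkExp_mono fun l' _ _ => ?_)
          (ih (hl.adj_finalState he) (hA.trans hle))
        have hsub : ((A.filter (· ∈ l)).filter fun v => j ≤ l'.count v) ⊆
            A.filter fun v => j + 1 ≤ (l ++ l').count v := by
          intro v hv
          simp only [mem_filter] at hv ⊢
          refine ⟨hv.1.1, ?_⟩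
          have := List.count_pos_iff.2 hv.1.2
          rw [List.count_append]
          omega
        have hcard : (((A.filter (· ∈ l)).filter fun v => j ≤ l'.count v).card : ℝ) ≤
            ((A.filter fun v => j + 1 ≤ (l ++ l').count v).card : ℝ) := by
          exact_mod_cast card_le_card hsub
        split_ifs with h1 h2 h2
        · exact le_rfl
        · linarith
        · simp
        · exact le_rfl
    refine (walkExp_mono fun l _ hl => hinner l hl).trans ?_
    rw [walkExp_add, walkExp_const hG hd]
    have hAN : N ≤ A.card := by
      refine hA.trans ?_
      have : κ ^ (j + 1) ≤ 1 := pow_le_one₀ hκ0 hκ1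
      nlinarith [(Nat.cast_nonneg A.card : (0 : ℝ) ≤ A.card)]
    have := hphase e he A hAN
    push_cast
    linarith

end NonBacktracking

/-! ### Both tails for given parameters -/

namespace NonBacktracking

open Finset

variable {V : Type*} [Fintype V] [DecidableEq V] {G : SimpleGraph V} [DecidableRel G.Adj]

lemma hitProb_return_le_of_mixing {n τ : ℕ} {ε : ℝ} (hn : 1 ≤ n)
    (hmix : ∀ e : V × V, G.Adj e.1 e.2 → ∀ t, τ ≤ t → ∀ x,
      |hitProb G t e x - 1 / n| ≤ 1 / (n : ℝ) ^ 2)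
    (hret : ∀ e : V × V, G.Adj e.1 e.2 → ∀ t, 1 ≤ t → hitProb G t e e.2 ≤ ε)
    (e : V × V) (he : G.Adj e.1 e.2) (t : ℕ) (ht : 1 ≤ t) :
    hitProb G t e e.2 ≤ (if t ≤ τ then ε else 0) + 2 / n := by
  have hn1 : (1 : ℝ) ≤ n := by exact_mod_cast hn
  split_ifs with h
  · have : 0 ≤ 2 / (n : ℝ) := by positivity
    linarith [hret e he t ht]
  · have h1 := (abs_le.1 (hmix e he t (by omega) e.2)).2
    have h2 : 1 / (n : ℝ) ^ 2 ≤ 1 / n := by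
      gcongr
      nlinarith
    have h3 : 2 / (n : ℝ) = 1 / n + 1 / n := by ring
    linarith

lemma walkExp_count_return_le {d : ℕ} (hG : G.IsRegularOfDegree d) (hd : 3 ≤ d) {τ : ℕ} {ε c : ℝ}
    (hε : 0 ≤ ε) (hb : ∀ e : V × V, G.Adj e.1 e.2 → ∀ t, 1 ≤ t →
      hitProb G t e e.2 ≤ (if t ≤ τ then ε else 0) + c) (M : ℕ) {e : V × V}
    (he : G.Adj e.1 e.2) :
    walkExp G M e (fun l => (l.count e.2 : ℝ)) ≤ τ * ε + M * c := by
  rw [walkExp_count hG hd]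
  calc ∑ t ∈ range M, hitProb G (t + 1) e e.2
      ≤ ∑ t ∈ range M, ((if t ∈ range τ then ε else 0) + c) := by
        refine sum_le_sum fun t _ => ?_
        simpa only [mem_range, Nat.succ_le_iff] using hb e he (t + 1) (by omega)
    _ = ∑ t ∈ range M ∩ range τ, ε + M * c := by
        rw [sum_add_distrib, sum_ite_mem, sum_const (b := c), card_range, nsmul_eq_mul]
    _ ≤ ∑ t ∈ range τ, ε + M * c := by
        refine add_le_add ?_ le_rfl
        exact sum_le_sum_of_subset_of_nonneg inter_subset_right fun _ _ _ => hε
    _ = τ * ε + M * c := by simp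

/-- Union bound over the vertices. Of `m + 2` visits one may be the start and one is the first
arrival; only the other `m` are returns that gain a factor. -/
lemma walkExp_exists_count_le {d : ℕ} (hG : G.IsRegularOfDegree d) (hd : 3 ≤ d) {τ : ℕ}
    {ε c θ : ℝ} (hε : 0 ≤ ε) (hc : 0 ≤ c) (hθ : 0 < θ)
    (hb : ∀ e : V × V, G.Adj e.1 e.2 → ∀ t, 1 ≤ t →
      hitProb G t e e.2 ≤ (if t ≤ τ then ε else 0) + c) (m T : ℕ) (w₀ : V) :
    walkExp G T (w₀, w₀) (fun l => if ∃ x, m + 2 ≤ (w₀ :: l).count x then 1 else 0) ≤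
      Fintype.card V * ((1 + θ) ^ T * (τ * ε + c / θ) ^ m) := by
  calc walkExp G T (w₀, w₀) (fun l => if ∃ x, m + 2 ≤ (w₀ :: l).count x then 1 else 0)
      ≤ walkExp G T (w₀, w₀) (fun l => ∑ x, if m + 1 ≤ l.count x then (1 : ℝ) else 0) := by
        refine walkExp_mono fun l _ _ => ?_
        have hnn : ∀ x ∈ univ, (0 : ℝ) ≤ if m + 1 ≤ l.count x then (1 : ℝ) else 0 := by
          intro x _; split_ifs <;> simp
        split_ifs with h
        · obtain ⟨x, hx⟩ := h
          rw [List.count_cons] at hx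
          have hx' : m + 1 ≤ l.count x := by split_ifs at hx <;> omega
          refine le_trans ?_ (single_le_sum hnn (mem_univ x))
          rw [if_pos hx']
        · exact sum_nonneg hnn
    _ = ∑ x, visitProb G (m + 1) T (w₀, w₀) x := walkExp_sum _ _ _ _
    _ ≤ ∑ _x : V, (1 + θ) ^ T * (τ * ε + c / θ) ^ m :=
        sum_le_sum fun x _ => visitProb_succ_le hG hd hε hc hθ hb m T _ x
    _ = _ := by rw [sum_const, card_univ, nsmul_eq_mul]

/-- The phases are applied to the set of all vertices, after one step that leads from the fresh
start to an edge state (hence the `+ 1` in `hj`). Left-over steps only increase the counts, and a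
positive bound for the number of vertices visited `j` times provides one. -/
lemma walkExp_forall_count_lt_le {n d : ℕ} (hG : G.IsRegularOfDegree d) (hd : 3 ≤ d)
    (hn : Fintype.card V = n) {τ M j : ℕ} {σ N : ℝ} (hM : 0 < M) (hN : 1 ≤ N)
    (hmix : ∀ e : V × V, G.Adj e.1 e.2 → ∀ t, τ ≤ t → ∀ x,
      |hitProb G t e x - 1 / n| ≤ 1 / (n : ℝ) ^ 2)
    (hσ0 : 0 ≤ σ) (hσ : ∀ M' ≤ M, ∀ e : V × V, G.Adj e.1 e.2 →
      walkExp G M' e (fun l => (l.count e.2 : ℝ)) ≤ σ)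
    (hj : j * (τ + M) + 1 ≤ n) (hMn : M ≤ n) (hNj : N ≤ ((M : ℝ) / (4 * n)) ^ j * n) (w₀ : V) :
    walkExp G n (w₀, w₀) (fun l => if ∀ x, (w₀ :: l).count x < j then 1 else 0) ≤
      j * (8 * (1 + 2 * τ) * n / (M * N) + 20 / n + 8 * σ) := by
  have hn1 : 1 ≤ n := by omega
  have hn0 : (0 : ℝ) < n := by exact_mod_cast hn1
  have hM0 : (0 : ℝ) < M := by exact_mod_cast hM
  have hN0 : 0 < N := by linarith
  set ζ : ℝ := 8 * (1 + 2 * τ) * n / (M * N) + 20 / n + 8 * σ with hζ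
  have hζ0 : 0 ≤ ζ := by positivity
  have hκ1 : (M : ℝ) / (4 * n) ≤ 1 := by
    rw [div_le_one (by positivity)]
    have : (M : ℝ) ≤ n := by exact_mod_cast hMn
    linarith
  have hphase : ∀ e : V × V, G.Adj e.1 e.2 → ∀ A : Finset V, N ≤ A.card →
      walkExp G (τ + M) e (fun l => if ((A.filter (· ∈ l)).card : ℝ) < (M : ℝ) / (4 * n) * A.card
        then 1 else 0) ≤ ζ := by
    intro e he A hA
    have hA0 : (0 : ℝ) < A.card := by linarith
    have hAne : A.Nonempty := card_pos.1 (by exact_mod_cast hA0)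
    refine (walkExp_card_lt_le hG hd hn1 hM hAne hmix hσ0 hσ he).trans ?_
    rw [hζ]
    gcongr
  obtain ⟨r, hr⟩ : ∃ r, n = (j * (τ + M) + r) + 1 := ⟨n - 1 - j * (τ + M), by omega⟩
  have hfirst : ∀ w ∈ nextVertices G (w₀, w₀), walkExp G (j * (τ + M) + r) (w₀, w)
      (fun l => if ∀ x, (w₀ :: w :: l).count x < j then 1 else 0) ≤ j * ζ := by
    intro w hw
    have hadj : G.Adj w₀ w := (mem_nextVertices.1 hw).2
    have hph := walkExp_phases_le hG hd (by positivity) hκ1 hζ0 hphase j (e := (w₀, w)) hadj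
      (A := univ) (by rwa [card_univ, hn])
    refine le_trans ?_ hph
    rw [walkExp_append]
    refine walkExp_mono fun l _ _ => ?_
    have hle : walkExp G r (finalState (w₀, w) l)
        (fun l' => if ∀ x, (w₀ :: w :: (l ++ l')).count x < j then 1 else 0) ≤
        walkExp G r (finalState (w₀, w) l) (fun _ =>
          if (((univ : Finset V).filter fun v => j ≤ l.count v).card : ℝ) <
            ((M : ℝ) / (4 * n)) ^ j * (univ : Finset V).card then 1 else 0) := by
      refine walkExp_mono fun l' _ _ => ?_
      split_ifs with h1 h2 h2
      · exact le_rfl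
      · exfalso
        apply h2
        have h0 : (univ : Finset V).filter (fun v => j ≤ l.count v) = ∅ := by
          refine filter_eq_empty_iff.2 fun v _ => ?_
          have h3 := h1 v
          simp only [List.count_cons, List.count_append] at h3
          omega
        rw [h0, card_univ, hn, card_empty, Nat.cast_zero]
        positivity
      · simp
      · exact le_rfl
    rwa [walkExp_const hG hd] at hle
  have h := walkExp_succ_le (F := fun l => if ∀ x, (w₀ :: l).count x < j then 1 else 0)
    (by positivity) hfirst
  rwa [← hr] at h

/-- A lower bound, for given parameters, for the probability that the maximal number of visits lies
in an interval. -/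
lemma one_sub_le_nonBacktrackingProb {n d : ℕ} {lam : ℝ} (hG : IsNDLGraph G n d lam) (hd : 3 ≤ d)
    {τ M j m : ℕ} {ε θ N a b : ℝ} (hM : 0 < M) (hN : 1 ≤ N) (hθ : 0 < θ) (hε : 0 ≤ ε)
    (hmix : ∀ e : V × V, G.Adj e.1 e.2 → ∀ t, τ ≤ t → ∀ x,
      |hitProb G t e x - 1 / n| ≤ 1 / (n : ℝ) ^ 2)
    (hret : ∀ e : V × V, G.Adj e.1 e.2 → ∀ t, 1 ≤ t → hitProb G t e e.2 ≤ ε)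
    (hj : j * (τ + M) + 1 ≤ n) (hMn : M ≤ n) (hNj : N ≤ ((M : ℝ) / (4 * n)) ^ j * n)
    (ha : a ≤ j) (hb : (m : ℝ) + 1 ≤ b) (w₀ : V) :
    1 - (n * ((1 + θ) ^ n * (τ * ε + 2 / n / θ) ^ m) +
      j * (8 * (1 + 2 * τ) * n / (M * N) + 20 / n + 8 * (τ * ε + M * (2 / n)))) ≤
      nonBacktrackingProb G w₀ n fun w => a ≤ (maxVisits w : ℝ) ∧ (maxVisits w : ℝ) ≤ b := by
  classical
  obtain ⟨hcard, hreg, -, -⟩ := hG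
  have hn1 : 1 ≤ n := by omega
  let Q : List V → Prop := fun l => a ≤ ((univ.sup fun v => l.count v : ℕ) : ℝ) ∧
    ((univ.sup fun v => l.count v : ℕ) : ℝ) ≤ b
  have hmax : (fun w : Fin (n + 1) → V => a ≤ (maxVisits w : ℝ) ∧ (maxVisits w : ℝ) ≤ b) =
      fun w => Q (List.ofFn w) := by
    funext w
    simp only [Q, maxVisits, visits_eq_count]
  have hret' := hitProb_return_le_of_mixing hn1 hmix hret
  have hup := walkExp_exists_count_le hreg hd hε (by positivity) hθ hret' m n w₀
  have hlow := walkExp_forall_count_lt_le (σ := τ * ε + M * (2 / n)) hreg hd hcard hM hN hmix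
    (by positivity) (fun M' hM' e he =>
      (walkExp_count_return_le hreg hd hε hret' M' he).trans (by gcongr)) hj hMn hNj w₀
  rw [hcard] at hup
  obtain ⟨k, rfl⟩ : ∃ k, n = k + 1 := ⟨n - 1, by omega⟩
  rw [hmax, nonBacktrackingProb_eq_walkExp hreg hd k w₀ Q]
  have hpt : ∀ l : List V, (1 : ℝ) ≤ @ite ℝ (Q (w₀ :: l)) (Classical.propDecidable _) 1 0 +
      ((if ∃ x, m + 2 ≤ (w₀ :: l).count x then 1 else 0) +
        (if ∀ x, (w₀ :: l).count x < j then 1 else 0)) := by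
    intro l
    by_cases h1 : ∃ x, m + 2 ≤ (w₀ :: l).count x
    · rw [if_pos h1]
      split_ifs <;> norm_num
    by_cases h2 : ∀ x, (w₀ :: l).count x < j
    · rw [if_pos h2]
      split_ifs <;> norm_num
    rw [if_neg h1, if_neg h2, if_pos]
    · norm_num
    push Not at h1 h2
    obtain ⟨x, hx⟩ := h2
    constructor
    · refine ha.trans (Nat.cast_le.2 (hx.trans ?_))
      exact le_sup (f := fun v => (w₀ :: l).count v) (mem_univ x)
    · refine le_trans ?_ hb
      have : (univ.sup fun v => (w₀ :: l).count v) ≤ m + 1 :=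
        Finset.sup_le fun v _ => by have := h1 v; omega
      exact_mod_cast this
  have hE := walkExp_mono (G := G) (k := k + 1) (p := (w₀, w₀)) (F := fun _ => 1)
    fun l _ _ => hpt l
  rw [walkExp_const hreg hd, walkExp_add, walkExp_add] at hE
  linarith

end NonBacktracking

/-! ### Choice of the parameters -/

namespace NonBacktracking

open Filter

/-- Since β ≤ exp(-(1 - δ/4) y), the power β^m has exponent about -(1 - δ/4)(1 + δ) ℓ ≤ -(1 + δ/2)
ℓ. This beats the n = exp ℓ vertices and leaves δℓ/8 after the lower-order terms. -/
lemma upper_tail_numeric {ℓ y δ β : ℝ} {m : ℕ} (hℓ : 0 < ℓ) (hy : 8 ≤ y)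
    (hyℓ : Real.log ℓ = y) (hδ0 : 0 < δ) (hδ1 : δ ≤ 1) (hyδ : 4 / δ ≤ y)
    (hlogy : Real.log (3 * y) ≤ δ / 4 * y) (hyl : 16 * y ≤ δ * ℓ)
    (hexp : Real.exp (-(δ / 8 * ℓ)) ≤ δ / 2) (hβ0 : 0 ≤ β) (hβ : β ≤ 3 * y / ℓ)
    (hm : (1 + δ) * (ℓ / y) - 2 ≤ m) :
    Real.exp ℓ * (Real.exp (ℓ / y) * β ^ m) ≤ δ / 2 := by
  have hy0 : 0 < y := by linarith
  have hβ' : β ≤ Real.exp (-((1 - δ / 4) * y)) := by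
    refine hβ.trans ?_
    rw [← Real.log_le_iff_le_exp (by positivity), Real.log_div (by positivity) hℓ.ne', hyℓ]
    linarith
  have hpow : β ^ m ≤ Real.exp (-((1 - δ / 4) * y) * m) := by
    rw [mul_comm _ (m : ℝ), Real.exp_nat_mul]
    exact pow_le_pow_left₀ hβ0 hβ' m
  refine le_trans ?_ hexp
  calc Real.exp ℓ * (Real.exp (ℓ / y) * β ^ m)
      ≤ Real.exp ℓ * (Real.exp (ℓ / y) * Real.exp (-((1 - δ / 4) * y) * m)) := by gcongr
    _ = Real.exp (ℓ + (ℓ / y + -((1 - δ / 4) * y) * m)) := by rw [Real.exp_add, Real.exp_add]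
    _ ≤ Real.exp (-(δ / 8 * ℓ)) := by
        refine Real.exp_le_exp.2 ?_
        have h1 : (1 - δ / 4) * y * ((1 + δ) * (ℓ / y) - 2) ≤ (1 - δ / 4) * y * m :=
          mul_le_mul_of_nonneg_left hm (mul_nonneg (by linarith) hy0.le)
        have h2 : (1 - δ / 4) * y * ((1 + δ) * (ℓ / y) - 2) =
            (1 - δ / 4) * (1 + δ) * ℓ - 2 * (1 - δ / 4) * y := by field_simp
        have h3 : ℓ / y ≤ δ / 4 * ℓ := by
          rw [div_le_iff₀ hy0]
          rw [div_le_iff₀ hδ0] at hyδ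
          nlinarith
        have h4 : (1 + δ / 2) * ℓ ≤ (1 - δ / 4) * (1 + δ) * ℓ :=
          mul_le_mul_of_nonneg_right (by nlinarith) hℓ.le
        have h5 : 2 * (1 - δ / 4) * y ≤ 2 * y := by nlinarith
        linarith

/-- Here κ ≥ exp(-(1 + δ/2) y), and (1 + δ/2)(1 - δ) ≤ 1 - δ/2, so κ^j exp ℓ is at least about
exp(δℓ/2), far above any power of ℓ. -/
lemma lower_tail_numeric {ℓ y δ κ : ℝ} {j : ℕ} (hℓ : 0 < ℓ) (hy : 8 ≤ y)
    (hyℓ : Real.log ℓ = y) (hδ0 : 0 < δ) (hδ1 : δ ≤ 1) (hyl : 16 * y ≤ δ * ℓ)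
    (hκ : 1 / (8 * (ℓ / y * Real.exp (δ / 2 * y))) ≤ κ)
    (hj : (j : ℝ) ≤ (1 - δ) * (ℓ / y) + 1) :
    ℓ ^ 5 ≤ κ ^ j * Real.exp ℓ := by
  have hy0 : 0 < y := by linarith
  have hℓy : Real.exp y = ℓ := by rw [← hyℓ, Real.exp_log hℓ]
  have hκ' : Real.exp (-((1 + δ / 2) * y)) ≤ κ := by
    refine le_trans ?_ hκ
    rw [Real.exp_neg, ← one_div]
    refine one_div_le_one_div_of_le (by positivity) ?_
    rw [show (1 + δ / 2) * y = y + δ / 2 * y by ring, Real.exp_add, hℓy, ← mul_assoc]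
    refine mul_le_mul_of_nonneg_right ?_ (Real.exp_nonneg _)
    rw [mul_div_assoc', div_le_iff₀ hy0]
    nlinarith
  have hpow : Real.exp (-((1 + δ / 2) * y) * j) ≤ κ ^ j := by
    rw [mul_comm _ (j : ℝ), Real.exp_nat_mul]
    exact pow_le_pow_left₀ (Real.exp_nonneg _) hκ' j
  calc ℓ ^ 5 = Real.exp (5 * y) := by
        rw [← hℓy, ← Real.exp_nat_mul]; norm_num
    _ ≤ Real.exp (-((1 + δ / 2) * y) * j + ℓ) := by
        refine Real.exp_le_exp.2 ?_
        have h1 : (1 + δ / 2) * y * j ≤ (1 + δ / 2) * y * ((1 - δ) * (ℓ / y) + 1) :=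
          mul_le_mul_of_nonneg_left hj (by positivity)
        have h2 : (1 + δ / 2) * y * ((1 - δ) * (ℓ / y) + 1) =
            (1 + δ / 2) * (1 - δ) * ℓ + (1 + δ / 2) * y := by field_simp
        have h3 : (1 + δ / 2) * (1 - δ) * ℓ ≤ (1 - δ / 2) * ℓ :=
          mul_le_mul_of_nonneg_right (by nlinarith) hℓ.le
        nlinarith
    _ = Real.exp (-((1 + δ / 2) * y) * j) * Real.exp ℓ := Real.exp_add _ _
    _ ≤ κ ^ j * Real.exp ℓ := by gcongr

/-- The repeats within a phase after mixing cost j M/n ≤ 1/K up to a constant, which is why phases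
must be shorter than n/L by the factor K. The other terms are O(1/ℓ). -/
lemma phase_error_numeric {n ℓ L K C D δ τ j M : ℝ} (hℓ : 1 ≤ ℓ) (hL0 : 0 < L) (hL : L ≤ ℓ)
    (hK0 : 0 < K) (hK : K ≤ ℓ) (hC : 0 < C) (hD : 0 ≤ D) (hn : ℓ ^ 2 ≤ n)
    (hj : j ≤ L) (hτ0 : 0 ≤ τ) (hτ : τ ≤ (C + 1) * ℓ) (hM : n / (2 * (L * K)) ≤ M)
    (hM' : M ≤ n / (L * K))
    (herr : (48 * (C + 1) + 20 + 8 * (C + 1) * D) / ℓ + 16 / K ≤ δ / 2) :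
    j * (8 * (1 + 2 * τ) * n / (M * ℓ ^ 5) + 20 / n + 8 * (τ * (D / ℓ ^ 5) + M * (2 / n))) ≤
      δ / 2 := by
  have hℓ0 : 0 < ℓ := by linarith
  have hn0 : 0 < n := lt_of_lt_of_le (by positivity) hn
  have hM0 : 0 < M := lt_of_lt_of_le (by positivity) hM
  have hjℓ : j ≤ ℓ := hj.trans hL
  have h1 : j * (8 * (1 + 2 * τ) * n / (M * ℓ ^ 5)) ≤ 48 * (C + 1) / ℓ := by
    have e1 : n / M ≤ 2 * ℓ ^ 2 := by
      rw [div_le_iff₀ hM0]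
      rw [div_le_iff₀ (by positivity)] at hM
      have : M * (2 * (L * K)) ≤ M * (2 * (ℓ * ℓ)) := by gcongr
      nlinarith
    have e2 : 8 * (1 + 2 * τ) ≤ 24 * (C + 1) * ℓ := by nlinarith
    calc j * (8 * (1 + 2 * τ) * n / (M * ℓ ^ 5)) = j * (8 * (1 + 2 * τ)) * (n / M) / ℓ ^ 5 := by
          field_simp
      _ ≤ ℓ * (24 * (C + 1) * ℓ) * (2 * ℓ ^ 2) / ℓ ^ 5 := by gcongr
      _ = 48 * (C + 1) / ℓ := by field_simp; ring
  have h2 : j * (20 / n) ≤ 20 / ℓ := by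
    calc j * (20 / n) ≤ ℓ * (20 / ℓ ^ 2) := by gcongr
      _ = 20 / ℓ := by field_simp
  have h3 : j * (8 * (τ * (D / ℓ ^ 5))) ≤ 8 * (C + 1) * D / ℓ := by
    calc j * (8 * (τ * (D / ℓ ^ 5))) ≤ ℓ * (8 * ((C + 1) * ℓ * (D / ℓ ^ 5))) := by gcongr
      _ = 8 * (C + 1) * D / ℓ ^ 3 := by field_simp
      _ ≤ 8 * (C + 1) * D / ℓ := by
          gcongr
          exact le_self_pow₀ hℓ (by norm_num)
  have h4 : j * (8 * (M * (2 / n))) ≤ 16 / K := by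
    calc j * (8 * (M * (2 / n))) ≤ L * (8 * (n / (L * K) * (2 / n))) := by gcongr
      _ = 16 / K := by field_simp; ring
  have h5 : (48 * (C + 1) + 20 + 8 * (C + 1) * D) / ℓ =
      48 * (C + 1) / ℓ + 20 / ℓ + 8 * (C + 1) * D / ℓ := by ring
  rw [h5] at herr
  linarith

/-- The choice of the parameters for large `n`. -/
lemma eventually_exists_parameters {δ C D : ℝ} (hδ0 : 0 < δ) (hδ1 : δ ≤ 1) (hC : 0 < C)
    (hD : 0 ≤ D) :
    ∀ᶠ n : ℕ in atTop, ∃ (τ M j m : ℕ) (θ N : ℝ), C * Real.log n ≤ τ ∧ 0 < M ∧ 1 ≤ N ∧ 0 < θ ∧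
      j * (τ + M) + 1 ≤ n ∧ M ≤ n ∧ N ≤ ((M : ℝ) / (4 * n)) ^ j * n ∧
      (1 - δ) * (Real.log n / Real.log (Real.log n)) ≤ j ∧
      (m : ℝ) + 1 ≤ (1 + δ) * (Real.log n / Real.log (Real.log n)) ∧
      n * ((1 + θ) ^ n * (τ * (D / Real.log n ^ 5) + 2 / n / θ) ^ m) ≤ δ / 2 ∧
      j * (8 * (1 + 2 * τ) * n / (M * N) + 20 / n + 8 * (τ * (D / Real.log n ^ 5) + M * (2 / n))) ≤
        δ / 2 := by
  have tℓ : Tendsto (fun n : ℕ => Real.log n) atTop atTop :=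
    Real.tendsto_log_atTop.comp tendsto_natCast_atTop_atTop
  have ty : Tendsto (fun n : ℕ => Real.log (Real.log n)) atTop atTop :=
    Real.tendsto_log_atTop.comp tℓ
  have lin : ∀ c : ℝ, 0 < c → ∀ᶠ x : ℝ in atTop, Real.log x ≤ c * x := by
    intro c hc
    filter_upwards [Real.isLittleO_log_id_atTop.bound hc, eventually_ge_atTop 0] with x hx hx0
    simp only [id, Real.norm_eq_abs, abs_of_nonneg hx0] at hx
    exact (le_abs_self _).trans hx
  have texp : ∀ c : ℝ, 0 < c → Tendsto (fun x : ℝ => Real.exp (-(c * x))) atTop (nhds 0) :=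
    fun c hc => Real.tendsto_exp_neg_atTop_nhds_zero.comp (tendsto_id.const_mul_atTop hc)
  have e_log3 : ∀ᶠ x : ℝ in atTop, Real.log (3 * x) ≤ δ / 4 * x := by
    have h := (tendsto_id.const_mul_atTop (by norm_num : (0 : ℝ) < 3)).eventually
      (lin (δ / 12) (by positivity))
    filter_upwards [h] with x hx
    simp only [id] at hx
    linarith
  have e_err : ∀ᶠ n : ℕ in atTop, (48 * (C + 1) + 20 + 8 * (C + 1) * D) / Real.log n +
      16 * Real.exp (-(δ / 2 * Real.log (Real.log n))) ≤ δ / 2 := by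
    have h1 : Tendsto (fun n : ℕ => (48 * (C + 1) + 20 + 8 * (C + 1) * D) / Real.log n) atTop
        (nhds 0) := tℓ.const_div_atTop _
    have h2 : Tendsto (fun n : ℕ => 16 * Real.exp (-(δ / 2 * Real.log (Real.log n)))) atTop
        (nhds (16 * 0)) := ((texp (δ / 2) (by positivity)).comp ty).const_mul 16
    have h3 := h1.add h2
    rw [mul_zero, add_zero] at h3
    exact h3.eventually_le_const (by positivity)
  have e_sq : ∀ᶠ n : ℕ in atTop, 4 * (C + 1) * Real.log n ^ 2 ≤ n := by
    have h := (Real.isLittleO_pow_log_id_atTop (n := 2)).bound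
      (by positivity : (0 : ℝ) < 1 / (4 * (C + 1)))
    filter_upwards [tendsto_natCast_atTop_atTop.eventually h] with n hn
    simp only [id, Real.norm_eq_abs, Nat.abs_cast] at hn
    have := (le_abs_self _).trans hn
    rw [div_mul_eq_mul_div, le_div_iff₀ (by positivity)] at this
    linarith
  filter_upwards [ty.eventually_ge_atTop 8, ty.eventually_ge_atTop (4 / δ), ty.eventually e_log3,
    tℓ.eventually (lin (δ / 16) (by positivity)), e_err, e_sq,
    ((texp (δ / 8) (by positivity)).comp tℓ).eventually_le_const (by positivity : 0 < δ / 2),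
    ((texp (δ / 2) (by positivity)).comp ty).eventually_le_const (by norm_num : (0 : ℝ) < 1 / 4),
    tℓ.eventually_ge_atTop ((C + 1) * D), tℓ.eventually_ge_atTop 16, eventually_ge_atTop 8]
    with n hy hyδ hlogy hyl herr hsq hexp hK4 hCD hℓ16 hn8
  set ℓ : ℝ := Real.log n with hℓ
  set y : ℝ := Real.log ℓ with hyℓ
  set L : ℝ := ℓ / y with hL
  set K : ℝ := Real.exp (δ / 2 * y) with hK
  simp only [Function.comp] at hexp hK4
  have hy0 : 0 < y := by linarith
  have hℓ0 : 0 < ℓ := by linarith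
  have hn0 : (0 : ℝ) < n := by positivity
  have hn8' : (8 : ℝ) ≤ n := by exact_mod_cast hn8
  have hyl' : 16 * y ≤ δ * ℓ := by linarith
  have hL0 : 0 < L := by positivity
  have hLℓ : L ≤ ℓ := div_le_self hℓ0.le (by linarith)
  have hδL : 16 ≤ δ * L := by rw [hL, mul_div_assoc', le_div_iff₀ hy0]; exact hyl'
  have hL16 : 16 ≤ L := hδL.trans (mul_le_of_le_one_left hL0.le hδ1)
  have hK0 : 0 < K := Real.exp_pos _
  have hKinv : Real.exp (-(δ / 2 * y)) = 1 / K := by rw [Real.exp_neg, one_div]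
  have hK4' : 4 ≤ K := by
    rw [hKinv, div_le_div_iff₀ hK0 (by norm_num)] at hK4
    linarith
  have hKℓ : K ≤ ℓ := by
    rw [← Real.exp_log hℓ0, ← hyℓ, hK]
    refine Real.exp_le_exp.2 ?_
    have := mul_le_mul_of_nonneg_right hδ1 hy0.le
    linarith
  have hexpℓ : Real.exp ℓ = n := Real.exp_log hn0
  have hsq' : 4 * ℓ ^ 2 ≤ n := by linarith [mul_nonneg hC.le (sq_nonneg ℓ)]
  have hLK : L * K ≤ ℓ ^ 2 := by rw [pow_two]; gcongr
  have hLK0 : 0 < L * K := by positivity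
  have hq : 2 ≤ n / (L * K) := by
    rw [le_div_iff₀ hLK0]
    linarith [sq_nonneg ℓ]
  have hM1 : (⌊(n : ℝ) / (L * K)⌋₊ : ℝ) ≤ n / (L * K) := Nat.floor_le (by positivity)
  have hM2 : n / (2 * (L * K)) ≤ (⌊(n : ℝ) / (L * K)⌋₊ : ℝ) := by
    have h1 := Nat.lt_floor_add_one ((n : ℝ) / (L * K))
    have h2 : (n : ℝ) / (2 * (L * K)) = n / (L * K) / 2 := by field_simp
    rw [h2]
    linarith
  have hτ2 : (⌈C * ℓ⌉₊ : ℝ) ≤ (C + 1) * ℓ := by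
    have := Nat.ceil_lt_add_one (by positivity : 0 ≤ C * ℓ)
    linarith
  have hδL1 : 0 ≤ (1 - δ) * L := mul_nonneg (by linarith) hL0.le
  have hj2 : (⌈(1 - δ) * L⌉₊ : ℝ) ≤ (1 - δ) * L + 1 := (Nat.ceil_lt_add_one hδL1).le
  have hjL : (⌈(1 - δ) * L⌉₊ : ℝ) ≤ L := by linarith
  have hm1 : 1 ≤ ⌊(1 + δ) * L⌋₊ := Nat.le_floor (by
    push_cast
    linarith)
  have hm2 : ((⌊(1 + δ) * L⌋₊ - 1 : ℕ) : ℝ) = (⌊(1 + δ) * L⌋₊ : ℝ) - 1 := by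
    rw [Nat.cast_sub hm1, Nat.cast_one]
  set τ : ℕ := ⌈C * ℓ⌉₊ with hτ
  set M : ℕ := ⌊(n : ℝ) / (L * K)⌋₊ with hM
  set j : ℕ := ⌈(1 - δ) * L⌉₊ with hj
  have hjM : (j : ℝ) * M ≤ n / 4 := by
    calc (j : ℝ) * M ≤ L * (n / (L * K)) := by gcongr
      _ = n / K := by field_simp
      _ ≤ n / 4 := by gcongr
  have hjτ : (j : ℝ) * τ ≤ n / 4 := by
    have : (j : ℝ) * τ ≤ ℓ * ((C + 1) * ℓ) :=
      mul_le_mul (hjL.trans hLℓ) hτ2 (by positivity) hℓ0.le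
    have e : ℓ * ((C + 1) * ℓ) = 4 * (C + 1) * ℓ ^ 2 / 4 := by ring
    linarith
  -- With θ = L/n the weight (1+θ)^n is at most exp L while 2/(nθ) = 2/L. The subtracted 1 makes the
  -- permitted `m + 1` visits fit below (1+δ)L.
  refine ⟨τ, M, j, ⌊(1 + δ) * L⌋₊ - 1, L / n, ℓ ^ 5, Nat.le_ceil _, ?_, ?_, by positivity, ?_, ?_,
    ?_, Nat.le_ceil _, ?_, ?_, ?_⟩
  · exact Nat.floor_pos.2 (by linarith)
  · exact one_le_pow₀ (by linarith)
  · have : (j : ℝ) * (τ + M) + 1 ≤ n := by rw [mul_add]; linarith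
    exact_mod_cast this
  · have h0 : 1 ≤ L * K := one_le_mul_of_one_le_of_one_le (by linarith) (by linarith)
    have h1 : (M : ℝ) ≤ n := hM1.trans (div_le_self hn0.le h0)
    exact_mod_cast h1
  · have h1 := lower_tail_numeric (κ := (M : ℝ) / (4 * n)) (j := j) hℓ0 hy rfl hδ0 hδ1 hyl' ?_ hj2
    · rwa [hexpℓ] at h1
    · rw [← hL, ← hK, le_div_iff₀ (by positivity)]
      refine le_trans (Eq.le ?_) hM2
      field_simp
      norm_num
  · rw [hm2, sub_add_cancel]
    exact Nat.floor_le (by positivity)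
  · have hβ : τ * (D / ℓ ^ 5) + 2 / n / (L / n) ≤ 3 * y / ℓ := by
      have e1 : 2 / (n : ℝ) / (L / n) = 2 * y / ℓ := by rw [hL]; field_simp
      have e2 : τ * (D / ℓ ^ 5) ≤ 1 / ℓ := by
        calc τ * (D / ℓ ^ 5) ≤ (C + 1) * ℓ * (D / ℓ ^ 5) := by gcongr
          _ = (C + 1) * D / ℓ ^ 4 := by field_simp
          _ ≤ ℓ / ℓ ^ 4 := by gcongr
          _ = 1 / ℓ ^ 3 := by field_simp
          _ ≤ 1 / ℓ := by
              gcongr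
              exact le_self_pow₀ (by linarith) (by norm_num)
      have e3 : 1 / ℓ ≤ y / ℓ := by gcongr; linarith
      rw [e1, show 3 * y / ℓ = y / ℓ + 2 * y / ℓ by ring]
      linarith
    have hup := upper_tail_numeric (m := ⌊(1 + δ) * L⌋₊ - 1) hℓ0 hy rfl hδ0 hδ1 hyδ hlogy hyl' hexp
      (by positivity) hβ (by rw [hm2]; linarith [Nat.lt_floor_add_one ((1 + δ) * L)])
    rw [hexpℓ] at hup
    refine le_trans ?_ hup
    have hθ : (1 + L / n) ^ n ≤ Real.exp (ℓ / y) := by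
      calc (1 + L / n) ^ n ≤ Real.exp (L / n) ^ n := by
            gcongr
            linarith [Real.add_one_le_exp (L / n)]
        _ = Real.exp (ℓ / y) := by
            rw [← Real.exp_nat_mul]
            congr 1
            rw [hL]
            field_simp
    gcongr
  · refine phase_error_numeric (L := L) (K := K) (C := C) (by linarith) hL0 hLℓ hK0 hKℓ hC hD
      (by linarith [sq_nonneg ℓ]) hjL (by positivity) hτ2 hM2 hM1 ?_
    rw [hKinv] at herr
    rwa [mul_one_div] at herr

end NonBacktracking

/-! ### The theorem -/

namespace NonBacktracking

/-- For the largest r with 2r below the girth, (d-1)^(2(r+1)) ≥ (d-1)^girth ≥ ℓ^10. Passing from r +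
1 to r costs the factor d - 1 ≤ d. -/
lemma hitProb_return_le_of_girth {V : Type*} [Fintype V] [DecidableEq V] {G : SimpleGraph V}
    [DecidableRel G.Adj] {d : ℕ} (hG : G.IsRegularOfDegree d) (hd : 3 ≤ d) {ℓ : ℝ} (hℓ : 1 < ℓ)
    (hgirth : 10 * Real.logb ((d : ℝ) - 1) ℓ ≤ (G.girth : ℝ)) {e : V × V} (he : G.Adj e.1 e.2)
    {t : ℕ} (ht : 1 ≤ t) : hitProb G t e e.2 ≤ d / ℓ ^ 5 := by
  have hd' : (3 : ℝ) ≤ d := by exact_mod_cast hd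
  set q : ℝ := (d : ℝ) - 1 with hq
  have hq1 : 1 < q := by linarith
  have hq0 : 0 < q := by linarith
  have hg : 0 < G.girth := by
    have h1 : 0 < Real.logb q ℓ := Real.logb_pos hq1 hℓ
    have h2 : (0 : ℝ) < G.girth := by linarith
    exact_mod_cast h2
  set r : ℕ := (G.girth - 1) / 2 with hr
  have hpow : (ℓ ^ 5) ^ 2 ≤ (q ^ (r + 1)) ^ 2 := by
    calc (ℓ ^ 5) ^ 2 = (q ^ Real.logb q ℓ) ^ 10 := by
          rw [Real.rpow_logb hq0 hq1.ne' (by linarith)]; ring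
      _ = q ^ (10 * Real.logb q ℓ) := by
          rw [← Real.rpow_natCast, ← Real.rpow_mul hq0.le, mul_comm]; norm_num
      _ ≤ q ^ (G.girth : ℝ) := Real.rpow_le_rpow_of_exponent_le hq1.le hgirth
      _ = q ^ G.girth := Real.rpow_natCast _ _
      _ ≤ q ^ ((r + 1) * 2) := pow_le_pow_right₀ hq1.le (by omega)
      _ = (q ^ (r + 1)) ^ 2 := pow_mul _ _ _
  have hpow' : ℓ ^ 5 ≤ q ^ (r + 1) :=
    (pow_le_pow_iff_left₀ (by positivity) (by positivity) two_ne_zero).1 hpow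
  refine (hitProb_return_le hG hd (r := r) (by omega) he ht).trans ?_
  calc (q ^ r)⁻¹ = q / q ^ (r + 1) := by rw [pow_succ]; field_simp
    _ ≤ d / ℓ ^ 5 := by
        gcongr
        linarith

/-- The maximal number of visits is within a factor `1 ± δ` of `log n / log log n` with probability
at least `1 - δ`, for all graphs on `n` vertices that satisfy the hypotheses. -/
def MaxVisitsConcentrated (d : ℕ) (lam₀ δ : ℝ) (n : ℕ) : Prop :=
  ∀ (V : Type*) [Fintype V] [DecidableEq V] (G : SimpleGraph V) [DecidableRel G.Adj] (lam : ℝ),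
    lam ≤ lam₀ → IsNDLGraph G n d lam →
    10 * Real.logb ((d : ℝ) - 1) (Real.log n) ≤ (G.girth : ℝ) →
    ∀ w₀ : V,
      1 - δ ≤ nonBacktrackingProb G w₀ n (fun w =>
        (1 - δ) * (Real.log n / Real.log (Real.log n)) ≤ (maxVisits w : ℝ) ∧
        (maxVisits w : ℝ) ≤ (1 + δ) * (Real.log n / Real.log (Real.log n)))

lemma eventually_maxVisitsConcentrated {d : ℕ} (hd : 3 ≤ d) {lam₀ : ℝ} (hlam₀ : lam₀ < d) {δ : ℝ}
    (hδ0 : 0 < δ) (hδ1 : δ ≤ 1) :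
    ∀ᶠ n : ℕ in Filter.atTop, MaxVisitsConcentrated d lam₀ δ n := by
  obtain ⟨C, hC, hmix⟩ := exists_mixing hd hlam₀
  have hℓ : ∀ᶠ n : ℕ in Filter.atTop, 1 < Real.log n :=
    (Real.tendsto_log_atTop.comp tendsto_natCast_atTop_atTop).eventually_gt_atTop 1
  filter_upwards [hmix, hℓ,
    eventually_exists_parameters hδ0 hδ1 hC (Nat.cast_nonneg d : (0 : ℝ) ≤ d)]
    with n hmix hℓ hparam
  intro V _ _ G _ lam hlam hG hgirth w₀
  obtain ⟨τ, M, j, m, θ, N, hτ, hM, hN, hθ, hj, hMn, hNj, ha, hb, hup, hlow⟩ := hparam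
  refine le_trans ?_ (one_sub_le_nonBacktrackingProb hG hd hM hN hθ
    (ε := d / Real.log n ^ 5) (by positivity)
    (fun e he t ht x => hmix V G lam hlam hG t (hτ.trans (by exact_mod_cast ht)) e he x)
    (fun e he t ht => hitProb_return_le_of_girth hG.2.1 hd hℓ hgirth he ht)
    hj hMn hNj ha hb w₀)
  linarith

/-- Diagonal choice: at n take δ = 1/(k+1) for the greatest k ≤ n whose threshold is at most n. The
case k = 0 has threshold 0 by `h1`, so such a k always exists. -/
lemma exists_tendsto_zero_of_eventually {P : ℝ → ℕ → Prop} (h1 : ∀ n, P 1 n)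
    (h : ∀ δ, 0 < δ → δ ≤ 1 → ∀ᶠ n in Filter.atTop, P δ n) :
    ∃ δ : ℕ → ℝ, Filter.Tendsto δ Filter.atTop (nhds 0) ∧ ∀ n, P (δ n) n := by
  have hN : ∀ k : ℕ, ∃ N : ℕ, (k = 0 → N = 0) ∧ ∀ n, N ≤ n → P (1 / ((k : ℝ) + 1)) n := by
    intro k
    rcases Nat.eq_zero_or_pos k with rfl | hk
    · exact ⟨0, fun _ => rfl, fun n _ => by simpa using h1 n⟩
    · obtain ⟨N, hN⟩ := Filter.eventually_atTop.1 (h (1 / ((k : ℝ) + 1)) (by positivity) (by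
        rw [div_le_one (by positivity)]
        linarith [(Nat.cast_nonneg k : (0 : ℝ) ≤ k)]))
      exact ⟨N, fun h0 => absurd h0 hk.ne', hN⟩
  choose N hN0 hN using hN
  let k : ℕ → ℕ := fun n => Nat.findGreatest (fun k => N k ≤ n) n
  have hk : ∀ n, N (k n) ≤ n := fun n =>
    Nat.findGreatest_spec (P := fun k => N k ≤ n) (Nat.zero_le n) (by simp [hN0 0 rfl])
  have hkt : Filter.Tendsto k Filter.atTop Filter.atTop := by
    refine Filter.tendsto_atTop.2 fun K => ?_
    filter_upwards [Filter.eventually_ge_atTop (max K (N K))] with n hn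
    exact Nat.le_findGreatest ((le_max_left _ _).trans hn) ((le_max_right _ _).trans hn)
  exact ⟨fun n => 1 / ((k n : ℝ) + 1), tendsto_one_div_add_atTop_nhds_zero_nat.comp hkt,
    fun n => hN _ _ (hk n)⟩

end NonBacktracking

theorem theorem2 (d : ℕ) (hd : 3 ≤ d) (lam₀ : ℝ) (hlam₀ : lam₀ < d) :
    ∃ δ η : ℕ → ℝ,
      Filter.Tendsto δ Filter.atTop (nhds 0) ∧ Filter.Tendsto η Filter.atTop (nhds 0) ∧
      ∀ (V : Type*) [Fintype V] [DecidableEq V] (G : SimpleGraph V) [DecidableRel G.Adj]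
        (n : ℕ) (lam : ℝ), lam ≤ lam₀ → IsNDLGraph G n d lam →
        10 * Real.logb ((d : ℝ) - 1) (Real.log n) ≤ (G.girth : ℝ) →
        ∀ w₀ : V,
          1 - η n ≤ nonBacktrackingProb G w₀ n (fun w =>
            (1 - δ n) * (Real.log n / Real.log (Real.log n)) ≤ (maxVisits w : ℝ) ∧
            (maxVisits w : ℝ) ≤ (1 + δ n) * (Real.log n / Real.log (Real.log n))) := by
  obtain ⟨δ, hδ, hP⟩ := NonBacktracking.exists_tendsto_zero_of_eventually
    (P := NonBacktracking.MaxVisitsConcentrated d lam₀)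
    (fun n V _ _ G _ lam _ _ _ w₀ => by
      -- For δ = 1 the claim only says that a probability is nonnegative.
      rw [sub_self]
      exact div_nonneg (Nat.cast_nonneg _) (Nat.cast_nonneg _))
    (fun δ hδ0 hδ1 => NonBacktracking.eventually_maxVisitsConcentrated hd hlam₀ hδ0 hδ1)
  exact ⟨δ, δ, hδ, hδ, fun V _ _ G _ n lam hlam hG hgirth w₀ =>
    hP n V G lam hlam hG hgirth w₀⟩
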